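/- Let $0<p,q<1$, and let $C(S^3_{pq})$ be the universal unital $C^*$-algebra generated by two elements $a,b$ subject to the relations \[ ab=ba,\quad ab^*=b^*a,\quad a^*b^*=b^*a^*,\quad a^*b=ba^*, \] \[ a^*a-q\,aa^*=1-q,\qquad b^*b-p\,bb^*=1-p,\qquad (1-aa^*)(1-bb^*)=0 . \] (It exists, since in every representation $\|a\|,\|b\|\le 1$.) Then $C(S^3_{pq})$ is a $2$-graph $C^*$-algebra: there is a row-finite, locally convex $2$-graph $\Lambda$ such that $C(S^3_{pq})$ is $*$-isomorphic to $C^*(\Lambda)$. Here a $k$-graph is a countable small category $\Lambda$ with a functor $d:\Lambda\to\mathbb N^k$ such that every $\lambda\in\Lambda$ with $d(\lambda)=m+n$ factors uniquely as $\lambda=\mu\nu$ with $d(\mu)=m$ and $d(\nu)=n$; the objects (vertices) are identified with the paths of degree $0$, and $r(\lambda)$, $s(\lambda)$ are the codomain and domain of $\lambda$. Write $v\Lambda^n=\{\lambda: r(\lambda)=v,\ d(\lambda)=n\}$, let $e_1,\dots,e_k$ be the standard generators of $\mathbb N^k$, and let $v\Lambda^{\le n}$ be the set of paths $\lambda$ with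 $r(\lambda)=v$, $d(\lambda)\le n$, such that $s(\lambda)\Lambda^{e_i}=\emptyset$ whenever $d(\lambda)+e_i\le n$. The $k$-graph is row-finite if every $v\Lambda^n$ is finite, and locally convex if for all $v$, all $i\ne j$ and every $\lambda\in v\Lambda^{e_i}$ such that $v\Lambda^{e_j}\neq\emptyset$, also $s(\lambda)\Lambda^{e_j}\ne\emptyset$. For such $\Lambda$, $C^*(\Lambda)$ is the universal $C^*$-algebra generated by elements $s_\lambda$ $(\lambda\in\Lambda)$ such that the $s_v$ ($v$ a vertex) are mutually orthogonal projections, $s_{\lambda\mu}=s_\lambda s_\mu$ whenever $s(\lambda)=r(\mu)$, $s_\lambda^*s_\lambda=s_{s(\lambda)}$ for all $\lambda$, and $s_v=\sum_{\lambda\in v\Lambda^{\le n}}s_\lambda s_\lambda^*$ for all vertices $v$ and all $n\in\mathbb N^k$. -/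

import Mathlib

open CategoryTheory
open scoped ENNReal

noncomputable section

/-! ### The universal C⋆-algebra `C(S³_pq)` -/

/-- The defining relations of the quantum three-sphere `S³_pq`, imposed on two elements `a`, `b` of
a unital `⋆`-algebra. -/
structure IsQuantumSpherePair (p q : ℝ) {B : Type*} [Ring B] [StarRing B] [Algebra ℂ B]
    (a b : B) : Prop where
  mul_comm : a * b = b * a
  mul_star_comm : a * star b = star b * a
  star_mul_star_comm : star a * star b = star b * star a
  star_mul_comm : star a * b = b * star a
  disc_a : star a * a - (q : ℂ) • (a * star a) = ((1 - q : ℝ) : ℂ) • (1 : B)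
  disc_b : star b * b - (p : ℂ) • (b * star b) = ((1 - p : ℝ) : ℂ) • (1 : B)
  sphere : (1 - a * star a) * (1 - b * star b) = 0

/-- In a C⋆-algebra, a solution of the disc relation with `0 < q < 1` has norm at most one. -/
theorem norm_le_one_of_disc {q : ℝ} (hq : q ∈ Set.Ioo (0 : ℝ) 1) {B : Type*} [CStarAlgebra B]
    [Nontrivial B] {x : B}
    (h : star x * x - (q : ℂ) • (x * star x) = ((1 - q : ℝ) : ℂ) • (1 : B)) : ‖x‖ ≤ 1 := by
  have h1 : star x * x = ((1 - q : ℝ) : ℂ) • (1 : B) + (q : ℂ) • (x * star x) := by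
    rw [← h]; abel
  have h2 : ‖x‖ * ‖x‖ ≤ (1 - q) + q * (‖x‖ * ‖x‖) := by
    calc ‖x‖ * ‖x‖ = ‖star x * x‖ := CStarRing.norm_star_mul_self.symm
      _ = ‖((1 - q : ℝ) : ℂ) • (1 : B) + (q : ℂ) • (x * star x)‖ := by rw [h1]
      _ ≤ ‖((1 - q : ℝ) : ℂ) • (1 : B)‖ + ‖(q : ℂ) • (x * star x)‖ := norm_add_le _ _
      _ = (1 - q) + q * (‖x‖ * ‖x‖) := by
        rw [norm_smul, norm_smul, CStarRing.norm_self_mul_star, CStarRing.norm_one,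
          Complex.norm_real, Complex.norm_real, Real.norm_of_nonneg (by linarith [hq.2]),
          Real.norm_of_nonneg hq.1.le, mul_one]
  have h3 : ‖x‖ * ‖x‖ ≤ 1 := by nlinarith [hq.2]
  nlinarith [norm_nonneg x]

/-- A representation of the relations of `S³_pq` in a (nonzero) unital C⋆-algebra. -/
structure QuantumSphereRep (p q : ℝ) : Type 1 where
  carrier : Type
  [cstar : CStarAlgebra carrier]
  [nontriv : Nontrivial carrier]
  a : carrier
  b : carrier
  rel : IsQuantumSpherePair p q a b

attribute [instance] QuantumSphereRep.cstar QuantumSphereRep.nontriv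

/-- The C⋆-algebra of bounded families in the product of the target algebras of all
representations of the relations of `S³_pq`. -/
abbrev QuantumSphereProd (p q : ℝ) : Type 1 :=
  lp (fun π : QuantumSphereRep p q => π.carrier) ∞

instance (p q : ℝ) : CStarAlgebra (QuantumSphereProd p q) where

/-- The canonical generator `a` of `C(S³_pq)`, whose coordinate at a representation is the image of
`a`; it is a bounded family because of the norm estimate. -/
def quantumSphereA (p : ℝ) {q : ℝ} (hq : q ∈ Set.Ioo (0 : ℝ) 1) : QuantumSphereProd p q :=
  ⟨fun π => π.a, memℓp_infty ⟨1, by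
    rintro _ ⟨π, rfl⟩; exact norm_le_one_of_disc hq π.rel.disc_a⟩⟩

/-- The canonical generator `b` of `C(S³_pq)`. -/
def quantumSphereB {p : ℝ} (q : ℝ) (hp : p ∈ Set.Ioo (0 : ℝ) 1) : QuantumSphereProd p q :=
  ⟨fun π => π.b, memℓp_infty ⟨1, by
    rintro _ ⟨π, rfl⟩; exact norm_le_one_of_disc hp π.rel.disc_b⟩⟩

/-- The C⋆-algebra `C(S³_pq)`: the universal unital C⋆-algebra on two generators subject to the
relations of `S³_pq`, realised as the closed unital `⋆`-subalgebra generated by the canonical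
generators in the product over all representations. The norm of a `⋆`-polynomial in the
generators is therefore the supremum of its norms over all representations. (Every C⋆-algebra
generated by countably many elements is isomorphic to one whose carrier lies in `Type`, so the
representations of the index type are all representations, up to isomorphism.) -/
def quantumSphereSubalgebra {p q : ℝ} (hp : p ∈ Set.Ioo (0 : ℝ) 1) (hq : q ∈ Set.Ioo (0 : ℝ) 1) :
    StarSubalgebra ℂ (QuantumSphereProd p q) :=
  (StarAlgebra.adjoin ℂ {quantumSphereA p hq, quantumSphereB q hp}).topologicalClosure

/-- The C⋆-algebra `C(S³_pq)`, as a type. -/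
abbrev QuantumSphere {p q : ℝ} (hp : p ∈ Set.Ioo (0 : ℝ) 1) (hq : q ∈ Set.Ioo (0 : ℝ) 1) :
    Type 1 :=
  quantumSphereSubalgebra hp hq

instance {p q : ℝ} (hp : p ∈ Set.Ioo (0 : ℝ) 1) (hq : q ∈ Set.Ioo (0 : ℝ) 1) :
    CStarAlgebra (QuantumSphere hp hq) :=
  StarSubalgebra.cstarAlgebra _ (h_closed := StarSubalgebra.isClosed_topologicalClosure _)

/-- The canonical generators satisfy the defining relations. -/
theorem quantumSphere_rel {p q : ℝ} (hp : p ∈ Set.Ioo (0 : ℝ) 1) (hq : q ∈ Set.Ioo (0 : ℝ) 1) :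
    IsQuantumSpherePair p q (quantumSphereA p hq) (quantumSphereB q hp) where
  mul_comm := by ext π; exact π.rel.mul_comm
  mul_star_comm := by ext π; exact π.rel.mul_star_comm
  star_mul_star_comm := by ext π; exact π.rel.star_mul_star_comm
  star_mul_comm := by ext π; exact π.rel.star_mul_comm
  disc_a := by ext π; exact π.rel.disc_a
  disc_b := by ext π; exact π.rel.disc_b
  sphere := by ext π; exact π.rel.sphere

/-- Universal property, existence: every pair in a unital C⋆-algebra that satisfies the relations
is the image of the canonical generators. -/
theorem quantumSphere_lift {p q : ℝ} (hp : p ∈ Set.Ioo (0 : ℝ) 1) (hq : q ∈ Set.Ioo (0 : ℝ) 1)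
    {B : Type} [CStarAlgebra B] [Nontrivial B] {a b : B} (h : IsQuantumSpherePair p q a b) :
    ∃ φ : QuantumSphere hp hq →⋆ₐ[ℂ] B, ∀ x : QuantumSphere hp hq,
      (x.1 = quantumSphereA p hq → φ x = a) ∧ (x.1 = quantumSphereB q hp → φ x = b) := by
  let π : QuantumSphereRep p q := ⟨B, a, b, h⟩
  refine ⟨{ toFun := fun x => (x.1 : ∀ π : QuantumSphereRep p q, π.carrier) π
            map_one' := rfl
            map_mul' := fun _ _ => rfl
            map_zero' := rfl
            map_add' := fun _ _ => rfl
            commutes' := fun _ => rfl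
            map_star' := fun _ => rfl }, fun x => ⟨fun hx => ?_, fun hx => ?_⟩⟩
  · change (x.1 : ∀ π : QuantumSphereRep p q, π.carrier) π = a
    rw [hx]; rfl
  · change (x.1 : ∀ π : QuantumSphereRep p q, π.carrier) π = b
    rw [hx]; rfl

/-! ### Higher-rank graphs and their C⋆-algebras -/

/-- A higher-rank graph of rank `k`: a countable small category with a degree functor to `ℕᵏ` that
has the unique factorisation property. The range of a path `f : u ⟶ v` is `v` and its source is
`u`, so that the product `μ ν` of paths with `s(μ) = r(ν)` is the composite `ν ≫ μ`. -/
structure HigherRankGraph (k : ℕ) : Type 1 where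
  Obj : Type
  [category : SmallCategory Obj]
  [countable_obj : Countable Obj]
  [countable_hom : ∀ u v : Obj, Countable (u ⟶ v)]
  /-- the degree of a path -/
  deg : ∀ {u v : Obj}, (u ⟶ v) → (Fin k → ℕ)
  deg_id : ∀ v : Obj, deg (𝟙 v) = 0
  deg_comp : ∀ {u v w : Obj} (f : u ⟶ v) (g : v ⟶ w), deg (f ≫ g) = deg g + deg f
  /-- if `d(h) = m + n`, then `h = μ ν` for unique `μ`, `ν` with `d(μ) = m` and `d(ν) = n` -/
  factorization : ∀ {u w : Obj} (h : u ⟶ w) (m n : Fin k → ℕ), deg h = m + n →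
    ∃! x : (v : Obj) × (u ⟶ v) × (v ⟶ w), deg x.2.2 = m ∧ deg x.2.1 = n ∧ x.2.1 ≫ x.2.2 = h

attribute [instance] HigherRankGraph.category HigherRankGraph.countable_obj
  HigherRankGraph.countable_hom

namespace HigherRankGraph

variable {k : ℕ} (Λ : HigherRankGraph k)

/-- The set `vΛⁿ` of paths of degree `n` with range `v`; a path with range `v` is a pair of its
source and a morphism. -/
def pathsTo (v : Λ.Obj) (n : Fin k → ℕ) : Set ((u : Λ.Obj) × (u ⟶ v)) :=
  {x | Λ.deg x.2 = n}

/-- The set `vΛ^{≤n}` of paths `μ` with range `v` and `d(μ) ≤ n` such that `s(μ)Λ^{e_i}` is empty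
whenever `d(μ) + e_i ≤ n`. -/
def pathsToLE (v : Λ.Obj) (n : Fin k → ℕ) : Set ((u : Λ.Obj) × (u ⟶ v)) :=
  {x | Λ.deg x.2 ≤ n ∧
    ∀ i : Fin k, Λ.deg x.2 + Pi.single i 1 ≤ n → Λ.pathsTo x.1 (Pi.single i 1) = ∅}

/-- Every vertex receives only finitely many paths of each degree. -/
def RowFinite : Prop :=
  ∀ (v : Λ.Obj) (n : Fin k → ℕ), (Λ.pathsTo v n).Finite

/-- If `v` receives edges `f` and `g` of two distinct colours `i` and `j`, then the source of `f`
receives an edge of colour `j` (and, by symmetry, the source of `g` one of colour `i`). -/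
def LocallyConvex : Prop :=
  ∀ (v : Λ.Obj) (i j : Fin k), i ≠ j → ∀ f ∈ Λ.pathsTo v (Pi.single i 1),
    (Λ.pathsTo v (Pi.single j 1)).Nonempty → (Λ.pathsTo f.1 (Pi.single j 1)).Nonempty

/-- A Cuntz–Krieger `Λ`-family in a `⋆`-algebra, for a row-finite (locally convex) graph `Λ`. The
projection at the vertex `v` is `s (𝟙 v)`. -/
structure IsCuntzKriegerFamily {B : Type*} [NonUnitalRing B] [StarRing B]
    (s : ∀ {u v : Λ.Obj}, (u ⟶ v) → B) : Prop where
  isStarProjection : ∀ v : Λ.Obj, IsStarProjection (s (𝟙 v))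
  orthogonal : ∀ v w : Λ.Obj, v ≠ w → s (𝟙 v) * s (𝟙 w) = 0
  comp : ∀ {u v w : Λ.Obj} (f : u ⟶ v) (g : v ⟶ w), s (f ≫ g) = s g * s f
  star_mul_self : ∀ {u v : Λ.Obj} (f : u ⟶ v), star (s f) * s f = s (𝟙 u)
  /-- the sum is finite, because the graph is row-finite -/
  sum_eq : ∀ (v : Λ.Obj) (n : Fin k → ℕ),
    s (𝟙 v) = ∑ᶠ x ∈ Λ.pathsToLE v n, s x.2 * star (s x.2)

variable {Λ}

/-- The elements of a Cuntz–Krieger family in a C⋆-algebra are partial isometries, hence of norm at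
most one. -/
theorem IsCuntzKriegerFamily.norm_le_one {B : Type*} [NonUnitalCStarAlgebra B]
    {s : ∀ {u v : Λ.Obj}, (u ⟶ v) → B} (hs : Λ.IsCuntzKriegerFamily s) {u v : Λ.Obj} (f : u ⟶ v) :
    ‖s f‖ ≤ 1 := by
  have h1 : ‖s (𝟙 u)‖ * ‖s (𝟙 u)‖ = ‖s (𝟙 u)‖ := by
    rw [← CStarRing.norm_star_mul_self, hs.star_mul_self]
  have h2 : ‖s f‖ * ‖s f‖ = ‖s (𝟙 u)‖ := by
    rw [← CStarRing.norm_star_mul_self, hs.star_mul_self]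
  have h3 : ‖s (𝟙 u)‖ ≤ 1 := by nlinarith [norm_nonneg (s (𝟙 u))]
  nlinarith [norm_nonneg (s f)]

variable (Λ)

/-- A Cuntz–Krieger `Λ`-family in some C⋆-algebra, which need not be unital. -/
structure Rep : Type 1 where
  carrier : Type
  [cstar : NonUnitalCStarAlgebra carrier]
  s : ∀ {u v : Λ.Obj}, (u ⟶ v) → carrier
  rel : Λ.IsCuntzKriegerFamily s

attribute [instance] Rep.cstar

/-- The C⋆-algebra of bounded families in the product of the target algebras of all Cuntz–Krieger
`Λ`-families. -/
abbrev RepProd : Type 1 :=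
  lp (fun π : Λ.Rep => π.carrier) ∞

/-- The canonical generator at a path, whose coordinate at a Cuntz–Krieger family is the element of
that family. -/
def gen {u v : Λ.Obj} (f : u ⟶ v) : Λ.RepProd :=
  ⟨fun π => π.s f, memℓp_infty ⟨1, by rintro _ ⟨π, rfl⟩; exact π.rel.norm_le_one f⟩⟩

/-- The C⋆-algebra `C⋆(Λ)` of a row-finite locally convex higher-rank graph: the universal
C⋆-algebra generated by a Cuntz–Krieger `Λ`-family, realised as the closed `⋆`-subalgebra generated
by the canonical generators in the product over all Cuntz–Krieger `Λ`-families. -/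
def cstarSubalgebra : NonUnitalStarSubalgebra ℂ Λ.RepProd :=
  (NonUnitalStarAlgebra.adjoin ℂ
    {x : Λ.RepProd | ∃ (u v : Λ.Obj) (f : u ⟶ v), x = Λ.gen f}).topologicalClosure

/-- The C⋆-algebra `C⋆(Λ)`, as a type. -/
abbrev GraphCStarAlgebra : Type 1 :=
  Λ.cstarSubalgebra

instance : NonUnitalCStarAlgebra Λ.GraphCStarAlgebra :=
  NonUnitalStarSubalgebra.nonUnitalCStarAlgebra _
    (h_closed := NonUnitalStarSubalgebra.isClosed_topologicalClosure _)

variable {Λ}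

/-- The sets over which the Cuntz–Krieger relations sum are finite. -/
theorem RowFinite.finite_pathsToLE (h : Λ.RowFinite) (v : Λ.Obj) (n : Fin k → ℕ) :
    (Λ.pathsToLE v n).Finite := by
  refine ((Set.finite_Iic n).biUnion fun m _ => h v m).subset fun x hx => ?_
  exact Set.mem_biUnion (Set.mem_Iic.2 hx.1) rfl

/-- The canonical generators form a Cuntz–Krieger family. -/
theorem gen_isCuntzKriegerFamily (h : Λ.RowFinite) :
    Λ.IsCuntzKriegerFamily (fun {_ _} f => Λ.gen f) where
  isStarProjection v := ⟨by ext π; exact (π.rel.isStarProjection v).isIdempotentElem,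
    by ext π; exact (π.rel.isStarProjection v).isSelfAdjoint⟩
  orthogonal v w hvw := by ext π; exact π.rel.orthogonal v w hvw
  comp f g := by ext π; exact π.rel.comp f g
  star_mul_self f := by ext π; exact π.rel.star_mul_self f
  sum_eq v n := by
    ext π
    have h1 := π.rel.sum_eq v n
    rw [finsum_mem_eq_finite_toFinset_sum _ (h.finite_pathsToLE v n)] at h1 ⊢
    rw [lp.coeFn_sum, Finset.sum_apply]
    exact h1

/-- Universal property, existence: every Cuntz–Krieger family in a C⋆-algebra is the image of the
canonical generators. -/
theorem graphCStarAlgebra_lift {B : Type} [NonUnitalCStarAlgebra B]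
    {s : ∀ {u v : Λ.Obj}, (u ⟶ v) → B} (hs : Λ.IsCuntzKriegerFamily s) :
    ∃ φ : Λ.GraphCStarAlgebra →⋆ₙₐ[ℂ] B, ∀ (x : Λ.GraphCStarAlgebra) {u v : Λ.Obj} (f : u ⟶ v),
      x.1 = Λ.gen f → φ x = s f := by
  let π : Λ.Rep := ⟨B, s, hs⟩
  refine ⟨{ toFun := fun x => (x.1 : ∀ π : Λ.Rep, π.carrier) π
            map_smul' := fun _ _ => rfl
            map_mul' := fun _ _ => rfl
            map_zero' := rfl
            map_add' := fun _ _ => rfl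
            map_star' := fun _ => rfl }, fun x u v f hx => ?_⟩
  change (x.1 : ∀ π : Λ.Rep, π.carrier) π = s f
  rw [hx]; rfl

end HigherRankGraph

end

/-!
The disc relation `a⋆a - q aa⋆ = 1 - q` carries the same information as the relation `S⋆S = 1`. If
`a` satisfies it, then `a⋆a ≥ 1 - q` is invertible, and the polar part `S = a (a⋆a)^(-1/2)` is an
isometry. The element `h = a⋆a` satisfies `h = (1 - q) + q S h S⋆`, and since `h ↦ q S h S⋆` is a
strict contraction this equation has at most one solution; for any isometry `S` the series
`∑ (1 - q) qⁿ Sⁿ S⋆ⁿ` is one, it is positive, and `S √h` satisfies the disc relation. So `a ↦ S`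
and `S ↦ S √h` are mutually inverse (`discGenerator_polarIsometry`, `polarIsometry_discGenerator`), and
each of the two elements lies in the unital C⋆-algebra generated by the other. Under this
correspondence, pairs satisfying the relations of `S³_pq` correspond to pairs of isometries `V 0`,
`V 1` that commute, together with adjoints, and satisfy `(1 - V 0 V 0⋆)(1 - V 1 V 1⋆) = 0`
(`IsSphereIsometryPair`).

The 2-graph is the action category of `ℕ²` on the set `{∗, 0, 1}` of vertices, where `∗` is fixed
and the generator `e_i` of `ℕ²` moves the vertex `i` to `∗` and fixes the other one: a path is a
pair of a source `u` and a degree `d`, and its range is `d • u`. Unique factorisation is automatic.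
A pair of isometries yields the Cuntz–Krieger family `s_(u, d) = V^d P_u`, where
`P_i = 1 - V i V i⋆` and `P_∗ = 1 - P_0 - P_1`; the Cuntz–Krieger sums telescope
(`IsSphereIsometryPair.isCuntzKriegerFamily_sphereFamily`). Conversely the sum of the edges of one
colour `i` of a Cuntz–Krieger family is an isometry with respect to the unit `e = ∑ s_v` of the
family; adding `1 - e` in the unitization gives a pair of isometries, and multiplication by `e`
recovers the family from it (`sphereGraph.familyUnit_mul_sphereFamily`).

Since both universal algebras are closed subalgebras of products over all representations,
re-indexing along the map from representations of `S³_pq` to Cuntz–Krieger families is a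
`⋆`-homomorphism `graphHom` on `C⋆(Λ)`. It is injective because every Cuntz–Krieger family is
recovered from a representation of `S³_pq`; hence it is isometric and has closed range, and
comparison of generators identifies the range with `C(S³_pq)`.
-/

noncomputable section

/-! ### The disc relation and isometries -/

section Disc

variable {A : Type*} [CStarAlgebra A]

theorem norm_le_one_of_star_mul_self_eq_one {S : A} (hS : star S * S = 1) : ‖S‖ ≤ 1 := by
  have h1 : ‖(1 : A)‖ * ‖(1 : A)‖ = ‖(1 : A)‖ := by
    rw [← CStarRing.norm_star_mul_self, star_one, mul_one]
  have h2 : ‖S‖ * ‖S‖ = ‖(1 : A)‖ := by rw [← CStarRing.norm_star_mul_self, hS]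
  have h3 : ‖(1 : A)‖ ≤ 1 := by nlinarith [norm_nonneg (1 : A)]
  nlinarith [norm_nonneg S]

/-- The map `D ↦ q S D S⋆` is a strict contraction, so that its only fixed point is zero. All
uniqueness and commutation statements about `discModulus` rest on this. -/
theorem eq_zero_of_eq_smul_conj {q : ℝ} (hq : q ∈ Set.Ioo (0 : ℝ) 1) {S D : A}
    (hS : star S * S = 1) (hD : D = (q : ℂ) • (S * D * star S)) : D = 0 := by
  have hS1 := norm_le_one_of_star_mul_self_eq_one hS
  have h1 : ‖S * D * star S‖ ≤ ‖D‖ := by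
    calc ‖S * D * star S‖ ≤ ‖S‖ * ‖D‖ * ‖star S‖ := by
          refine (norm_mul_le _ _).trans ?_
          gcongr
          exact norm_mul_le _ _
      _ ≤ 1 * ‖D‖ * 1 := by
          rw [norm_star]
          gcongr
      _ = ‖D‖ := by ring
  have h2 : ‖D‖ ≤ q * ‖D‖ := by
    conv_lhs => rw [hD]
    rw [norm_smul, Complex.norm_real, Real.norm_of_nonneg hq.1.le]
    exact mul_le_mul_of_nonneg_left h1 hq.1.le
  exact norm_eq_zero.1 (by nlinarith [norm_nonneg D, hq.2])

/-- The element `h = ∑ (1 - q) qⁿ Sⁿ S⋆ⁿ`, which is the square `a⋆a` of the modulus of the solution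
`a` of the disc relation with polar part `S`. It is meaningful for an isometry `S`, where the
series converges in norm. -/
def discModulus (q : ℝ) (S : A) : A :=
  ∑' n : ℕ, (((1 - q) * q ^ n : ℝ) : ℂ) • (S ^ n * star S ^ n)

theorem summable_discModulus {q : ℝ} (hq : q ∈ Set.Ioo (0 : ℝ) 1) {S : A}
    (hS : star S * S = 1) :
    Summable fun n : ℕ => (((1 - q) * q ^ n : ℝ) : ℂ) • (S ^ n * star S ^ n) := by
  have hS1 := norm_le_one_of_star_mul_self_eq_one hS
  refine Summable.of_norm_bounded_eventually_nat (g := fun n => (1 - q) * q ^ n)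
    ((summable_geometric_of_lt_one hq.1.le hq.2).mul_left _) ?_
  filter_upwards [Filter.eventually_gt_atTop 0] with n hn
  have h0 : 0 ≤ (1 - q) * q ^ n := mul_nonneg (by linarith [hq.2]) (pow_nonneg hq.1.le n)
  rw [norm_smul, Complex.norm_real, Real.norm_of_nonneg h0, ← star_pow]
  refine mul_le_of_le_one_right h0 ?_
  rw [CStarRing.norm_self_mul_star]
  have h1 : ‖S ^ n‖ ≤ 1 := (norm_pow_le' S hn).trans (pow_le_one₀ (norm_nonneg _) hS1)
  exact mul_le_one₀ h1 (norm_nonneg _) h1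

theorem discModulus_eq {q : ℝ} (hq : q ∈ Set.Ioo (0 : ℝ) 1) {S : A} (hS : star S * S = 1) :
    discModulus q S =
      ((1 - q : ℝ) : ℂ) • (1 : A) + (q : ℂ) • (S * discModulus q S * star S) := by
  have h := summable_discModulus hq hS
  conv_lhs => rw [discModulus, h.tsum_eq_zero_add]
  congr 1
  · simp
  · rw [discModulus, ← h.tsum_mul_left, ← (h.mul_left S).tsum_mul_right,
      ← ((h.mul_left S).mul_right (star S)).tsum_const_smul]
    refine tsum_congr fun n => ?_
    rw [mul_smul_comm, smul_mul_assoc, smul_smul, pow_succ' S, pow_succ (star S)]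
    simp only [mul_assoc]
    congr 1
    push_cast
    ring

theorem discModulus_nonneg [PartialOrder A] [StarOrderedRing A] {q : ℝ}
    (hq : q ∈ Set.Ioo (0 : ℝ) 1) (S : A) : 0 ≤ discModulus q S := by
  refine tsum_nonneg fun n => ?_
  have h0 : 0 ≤ (1 - q) * q ^ n := mul_nonneg (by linarith [hq.2]) (pow_nonneg hq.1.le n)
  rw [← star_pow, Complex.coe_smul]
  exact smul_nonneg h0 (mul_star_self_nonneg _)

theorem eq_discModulus {q : ℝ} (hq : q ∈ Set.Ioo (0 : ℝ) 1) {S h : A} (hS : star S * S = 1)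
    (hh : h = ((1 - q : ℝ) : ℂ) • (1 : A) + (q : ℂ) • (S * h * star S)) :
    h = discModulus q S := by
  refine sub_eq_zero.1 (eq_zero_of_eq_smul_conj hq hS ?_)
  conv_lhs => rw [hh, discModulus_eq hq hS]
  rw [mul_sub, sub_mul, smul_sub]
  abel

theorem commute_discModulus {q : ℝ} (hq : q ∈ Set.Ioo (0 : ℝ) 1) {S y : A}
    (hS : star S * S = 1) (h1 : Commute y S) (h2 : Commute y (star S)) :
    Commute y (discModulus q S) := by
  refine sub_eq_zero.1 (eq_zero_of_eq_smul_conj hq hS ?_)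
  conv_lhs => rw [discModulus_eq hq hS]
  have e1 : y * (S * discModulus q S * star S) = S * (y * discModulus q S) * star S := by
    simp only [← mul_assoc, h1.eq]
  have e2 : S * discModulus q S * star S * y = S * (discModulus q S * y) * star S := by
    simp only [mul_assoc, h2.eq]
  rw [mul_add, add_mul, mul_smul_comm, mul_smul_comm, smul_mul_assoc, smul_mul_assoc, e1, e2,
    mul_sub, sub_mul, smul_sub, mul_one, one_mul]
  abel

/-- The solution `S √h` of the disc relation with parameter `q` whose polar part is the isometry
`S`. -/
def discGenerator (q : ℝ) (S : A) : A := S * cfc Real.sqrt (discModulus q S)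

/-- The element `a (a⋆a)^(-1/2)`. If `a⋆a` is invertible, then it is the isometry in the polar
decomposition of `a`. -/
def polarIsometry (a : A) : A := a * cfc (fun t : ℝ => (Real.sqrt t)⁻¹) (star a * a)

theorem isSelfAdjoint_discModulus {q : ℝ}
    (hq : q ∈ Set.Ioo (0 : ℝ) 1) (S : A) : IsSelfAdjoint (discModulus q S) := by
  let _ := CStarAlgebra.spectralOrder A
  have := CStarAlgebra.spectralOrderedRing A
  exact (discModulus_nonneg hq S).isSelfAdjoint

theorem cfc_sqrt_mul_self {h : A} (hh : IsSelfAdjoint h) (hs : ∀ x ∈ spectrum ℝ h, 0 ≤ x) :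
    cfc Real.sqrt h * cfc Real.sqrt h = h := by
  rw [← cfc_mul Real.sqrt Real.sqrt h]
  conv_rhs => rw [← cfc_id ℝ h]
  exact cfc_congr fun x hx => Real.mul_self_sqrt (hs x hx)

theorem star_discGenerator_mul_self {q : ℝ} (hq : q ∈ Set.Ioo (0 : ℝ) 1) {S : A}
    (hS : star S * S = 1) : star (discGenerator q S) * discGenerator q S = discModulus q S := by
  let _ := CStarAlgebra.spectralOrder A
  have := CStarAlgebra.spectralOrderedRing A
  have h := cfc_sqrt_mul_self (isSelfAdjoint_discModulus hq S)
    (fun x hx => spectrum_nonneg_of_nonneg (discModulus_nonneg hq S) hx)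
  have hs : star (cfc Real.sqrt (discModulus q S)) = cfc Real.sqrt (discModulus q S) :=
    (cfc_predicate (R := ℝ) Real.sqrt (discModulus q S)).star_eq
  rw [discGenerator, star_mul, hs, mul_assoc, ← mul_assoc (star S), hS, one_mul, h]

theorem discGenerator_mul_star_self {q : ℝ} (hq : q ∈ Set.Ioo (0 : ℝ) 1) {S : A} :
    discGenerator q S * star (discGenerator q S) = S * discModulus q S * star S := by
  let _ := CStarAlgebra.spectralOrder A
  have := CStarAlgebra.spectralOrderedRing A
  have h := cfc_sqrt_mul_self (isSelfAdjoint_discModulus hq S)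
    (fun x hx => spectrum_nonneg_of_nonneg (discModulus_nonneg hq S) hx)
  have hs : star (cfc Real.sqrt (discModulus q S)) = cfc Real.sqrt (discModulus q S) :=
    (cfc_predicate (R := ℝ) Real.sqrt (discModulus q S)).star_eq
  rw [discGenerator, star_mul, hs, mul_assoc, ← mul_assoc _ _ (star S), h, ← mul_assoc]

theorem discGenerator_disc {q : ℝ} (hq : q ∈ Set.Ioo (0 : ℝ) 1) {S : A} (hS : star S * S = 1) :
    star (discGenerator q S) * discGenerator q S
      - (q : ℂ) • (discGenerator q S * star (discGenerator q S))
      = ((1 - q : ℝ) : ℂ) • (1 : A) := by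
  rw [star_discGenerator_mul_self hq hS, discGenerator_mul_star_self hq, sub_eq_iff_eq_add]
  exact discModulus_eq hq hS

/-- The disc relation gives `a⋆a = (1 - q) + q aa⋆ ≥ 1 - q`. -/
theorem spectrum_pos_of_disc {q : ℝ} (hq : q ∈ Set.Ioo (0 : ℝ) 1) {a : A}
    (h : star a * a - (q : ℂ) • (a * star a) = ((1 - q : ℝ) : ℂ) • (1 : A)) :
    ∀ x ∈ spectrum ℝ (star a * a), 0 < x := by
  let _ := CStarAlgebra.spectralOrder A
  have := CStarAlgebra.spectralOrderedRing A
  have h1 : algebraMap ℝ A (1 - q) ≤ star a * a := by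
    rw [sub_eq_iff_eq_add] at h
    rw [h, Algebra.algebraMap_eq_smul_one, Complex.coe_smul, Complex.coe_smul]
    exact le_add_of_nonneg_right (smul_nonneg hq.1.le (mul_star_self_nonneg _))
  intro x hx
  have := (algebraMap_le_iff_le_spectrum (IsSelfAdjoint.star_mul_self a)).1 h1 x hx
  linarith [hq.2]

theorem cfc_sqrt_mul_inv {h : A} (hh : IsSelfAdjoint h) (hs : ∀ x ∈ spectrum ℝ h, 0 < x) :
    cfc Real.sqrt h * cfc (fun t : ℝ => (Real.sqrt t)⁻¹) h = 1 := by
  have hc : ContinuousOn (fun t : ℝ => (Real.sqrt t)⁻¹) (spectrum ℝ h) :=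
    Real.continuous_sqrt.continuousOn.inv₀ fun x hx => (Real.sqrt_pos.2 (hs x hx)).ne'
  rw [← cfc_mul Real.sqrt _ h, ← cfc_one ℝ h]
  exact cfc_congr fun x hx => mul_inv_cancel₀ (Real.sqrt_pos.2 (hs x hx)).ne'

theorem polarIsometry_mul_sqrt {q : ℝ} (hq : q ∈ Set.Ioo (0 : ℝ) 1) {a : A}
    (h : star a * a - (q : ℂ) • (a * star a) = ((1 - q : ℝ) : ℂ) • (1 : A)) :
    polarIsometry a * cfc Real.sqrt (star a * a) = a := by
  rw [polarIsometry, mul_assoc, (cfc_commute_cfc _ _ _).eq,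
    cfc_sqrt_mul_inv (IsSelfAdjoint.star_mul_self a) (spectrum_pos_of_disc hq h), mul_one]

theorem star_polarIsometry_mul_self {q : ℝ} (hq : q ∈ Set.Ioo (0 : ℝ) 1) {a : A}
    (h : star a * a - (q : ℂ) • (a * star a) = ((1 - q : ℝ) : ℂ) • (1 : A)) :
    star (polarIsometry a) * polarIsometry a = 1 := by
  have h1 := cfc_sqrt_mul_inv (IsSelfAdjoint.star_mul_self a) (spectrum_pos_of_disc hq h)
  have h2 := cfc_sqrt_mul_self (IsSelfAdjoint.star_mul_self a)
    fun x hx => (spectrum_pos_of_disc hq h x hx).le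
  have hs : star (cfc (fun t : ℝ => (Real.sqrt t)⁻¹) (star a * a)) = _ :=
    (cfc_predicate (R := ℝ) (fun t : ℝ => (Real.sqrt t)⁻¹) (star a * a)).star_eq
  have h3 := h1
  rw [(cfc_commute_cfc _ _ _).eq] at h3
  rw [polarIsometry, star_mul, hs, mul_assoc, ← mul_assoc (star a)]
  conv_lhs => enter [2, 1]; rw [← h2]
  rw [mul_assoc, h1, mul_one, h3]

theorem polarIsometry_discGenerator {q : ℝ} (hq : q ∈ Set.Ioo (0 : ℝ) 1) {S : A}
    (hS : star S * S = 1) : polarIsometry (discGenerator q S) = S := by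
  have h1 := cfc_sqrt_mul_inv (IsSelfAdjoint.star_mul_self _)
    (spectrum_pos_of_disc hq (discGenerator_disc hq hS))
  rw [polarIsometry]
  rw [star_discGenerator_mul_self hq hS] at h1 ⊢
  rw [discGenerator, mul_assoc, h1, mul_one]

theorem discModulus_polarIsometry {q : ℝ} (hq : q ∈ Set.Ioo (0 : ℝ) 1) {a : A}
    (h : star a * a - (q : ℂ) • (a * star a) = ((1 - q : ℝ) : ℂ) • (1 : A)) :
    discModulus q (polarIsometry a) = star a * a := by
  refine (eq_discModulus hq (star_polarIsometry_mul_self hq h) ?_).symm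
  have h2 := cfc_sqrt_mul_self (IsSelfAdjoint.star_mul_self a)
    fun x hx => (spectrum_pos_of_disc hq h x hx).le
  have hs : star (cfc Real.sqrt (star a * a)) = _ :=
    (cfc_predicate (R := ℝ) Real.sqrt (star a * a)).star_eq
  have h3 : a * star a = polarIsometry a * (star a * a) * star (polarIsometry a) := by
    conv_lhs => rw [← polarIsometry_mul_sqrt hq h]
    rw [star_mul, hs, mul_assoc, ← mul_assoc _ _ (star _), h2, ← mul_assoc]
  rw [← h3, ← h]
  abel

theorem discGenerator_polarIsometry {q : ℝ} (hq : q ∈ Set.Ioo (0 : ℝ) 1) {a : A}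
    (h : star a * a - (q : ℂ) • (a * star a) = ((1 - q : ℝ) : ℂ) • (1 : A)) :
    discGenerator q (polarIsometry a) = a := by
  rw [discGenerator, discModulus_polarIsometry hq h, polarIsometry_mul_sqrt hq h]

theorem commute_discGenerator {q : ℝ} (hq : q ∈ Set.Ioo (0 : ℝ) 1) {S y : A}
    (hS : star S * S = 1) (h1 : Commute y S) (h2 : Commute y (star S)) :
    Commute y (discGenerator q S) :=
  h1.mul_right ((commute_discModulus hq hS h1 h2).symm.cfc_real _).symm

theorem commute_polarIsometry {a y : A} (h1 : Commute y a) (h2 : Commute y (star a)) :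
    Commute y (polarIsometry a) :=
  h1.mul_right ((h2.mul_right h1).symm.cfc_real _).symm

theorem map_polarIsometry {B : Type*} [CStarAlgebra B] (φ : A →⋆ₐ[ℂ] B) {q : ℝ}
    (hq : q ∈ Set.Ioo (0 : ℝ) 1) {a : A}
    (h : star a * a - (q : ℂ) • (a * star a) = ((1 - q : ℝ) : ℂ) • (1 : A)) :
    φ (polarIsometry a) = polarIsometry (φ a) := by
  have hc : ContinuousOn (fun t : ℝ => (Real.sqrt t)⁻¹) (spectrum ℝ (star a * a)) :=
    Real.continuous_sqrt.continuousOn.inv₀ fun x hx =>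
      (Real.sqrt_pos.2 (spectrum_pos_of_disc hq h x hx)).ne'
  have hφ : Continuous φ :=
    (NonUnitalStarAlgHom.instContinuousLinearMapClassComplex
      (F := A →⋆ₐ[ℂ] B)).toContinuousMapClass.map_continuous φ
  rw [polarIsometry, polarIsometry, map_mul, StarAlgHomClass.map_cfc φ _ _ hc hφ
    (IsSelfAdjoint.star_mul_self a) ((IsSelfAdjoint.star_mul_self a).map φ), map_mul, map_star]

theorem polarIsometry_mem (N : StarSubalgebra ℂ A) (hN : IsClosed (N : Set A)) {a : A}
    (ha : a ∈ N) : polarIsometry a ∈ N :=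
  have := hN
  mul_mem ha (cfc_mem _ (mul_mem (star_mem ha) ha))

theorem discGenerator_mem (N : StarSubalgebra ℂ A) (hN : IsClosed (N : Set A)) {q : ℝ} {S : A}
    (hS : S ∈ N) : discGenerator q S ∈ N := by
  have := hN
  refine mul_mem hS (cfc_mem _ ?_)
  by_cases h : Summable fun n : ℕ => (((1 - q) * q ^ n : ℝ) : ℂ) • (S ^ n * star S ^ n)
  · refine hN.mem_of_tendsto h.hasSum (Filter.Eventually.of_forall fun s => ?_)
    exact sum_mem fun n _ => N.smul_mem (mul_mem (pow_mem hS n) (pow_mem (star_mem hS) n)) _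
  · rw [discModulus, tsum_eq_zero_of_not_summable h]
    exact zero_mem N

end Disc

/-! ### Pairs of generators and pairs of isometries -/

/-- A pair of isometries that commute with each other and with the adjoints of each other, and
whose defect projections `1 - V i V i⋆` are orthogonal. -/
structure IsSphereIsometryPair {A : Type*} [Ring A] [StarRing A] (V : Fin 2 → A) : Prop where
  isometry : ∀ i, star (V i) * V i = 1
  comm : ∀ i j, i ≠ j → Commute (V i) (V j)
  star_comm : ∀ i j, i ≠ j → Commute (star (V i)) (V j)
  defect : ∀ i j, i ≠ j → (1 - V i * star (V i)) * (1 - V j * star (V j)) = 0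

theorem IsSphereIsometryPair.of_pair {A : Type*} [Ring A] [StarRing A] {S T : A}
    (hS : star S * S = 1) (hT : star T * T = 1) (h1 : Commute S T) (h2 : Commute (star S) T)
    (h3 : (1 - S * star S) * (1 - T * star T) = 0) : IsSphereIsometryPair ![S, T] where
  isometry := by simp [Fin.forall_fin_two, hS, hT]
  comm := by simp [Fin.forall_fin_two, h1, h1.symm]
  star_comm := by
    have h2' := h2.symm.star_star
    rw [star_star] at h2'
    simp [Fin.forall_fin_two, h2, h2'] 
  defect := by
    have h3' := congrArg star h3
    simp only [star_mul, star_sub, star_one, star_star, star_zero] at h3'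
    simp [Fin.forall_fin_two, h3, h3']

section

variable {A : Type*} [CStarAlgebra A] {p q : ℝ}

theorem IsQuantumSpherePair.isSphereIsometryPair
    (hp : p ∈ Set.Ioo (0 : ℝ) 1) (hq : q ∈ Set.Ioo (0 : ℝ) 1) {a b : A}
    (h : IsQuantumSpherePair p q a b) :
    IsSphereIsometryPair ![polarIsometry a, polarIsometry b] := by
  have ia := star_polarIsometry_mul_self hq h.disc_a
  have ib := star_polarIsometry_mul_self hp h.disc_b
  have c1 : Commute a (polarIsometry b) := commute_polarIsometry h.mul_comm h.mul_star_comm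
  have c2 : Commute (star a) (polarIsometry b) :=
    commute_polarIsometry h.star_mul_comm h.star_mul_star_comm
  refine .of_pair ia ib (commute_polarIsometry c1.symm c2.symm).symm ?_ ?_
  · have c3 : Commute (star (polarIsometry b)) (polarIsometry a) :=
      commute_polarIsometry (by simpa using c2.star_star.symm) c1.star_star.symm
    simpa using c3.star_star.symm
  -- As `a` has the range of its polar part, `1 - SS⋆` is absorbed by `1 - aa⋆`; likewise for `b`.
  · have e1 : (1 - polarIsometry a * star (polarIsometry a)) * (1 - a * star a)
        = 1 - polarIsometry a * star (polarIsometry a) := by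
      have : (1 - polarIsometry a * star (polarIsometry a)) * a = 0 := by
        conv_lhs => enter [2]; rw [← polarIsometry_mul_sqrt hq h.disc_a]
        rw [← mul_assoc, sub_mul, mul_assoc (polarIsometry a), ia, mul_one, one_mul, sub_self,
          zero_mul]
      rw [mul_sub, mul_one, ← mul_assoc, this, zero_mul, sub_zero]
    have e2 : (1 - b * star b) * (1 - polarIsometry b * star (polarIsometry b))
        = 1 - polarIsometry b * star (polarIsometry b) := by
      have : star b * (1 - polarIsometry b * star (polarIsometry b)) = 0 := by
        have h0 : (1 - polarIsometry b * star (polarIsometry b)) * b = 0 := by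
          conv_lhs => enter [2]; rw [← polarIsometry_mul_sqrt hp h.disc_b]
          rw [← mul_assoc, sub_mul, mul_assoc (polarIsometry b), ib, mul_one, one_mul, sub_self,
            zero_mul]
        simpa using congrArg star h0
      rw [sub_mul, one_mul, mul_assoc b, this, mul_zero, sub_zero]
    rw [← e1, ← e2, mul_assoc, ← mul_assoc (1 - a * star a), h.sphere, zero_mul, mul_zero]

/-- The element `x = 1 - aa⋆` satisfies `x = (1 - SS⋆) + q S x S⋆`, that is,
`x = ∑ qⁿ Sⁿ (1 - SS⋆) S⋆ⁿ`. -/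
theorem one_sub_discGenerator_mul_star {r : ℝ} (hr : r ∈ Set.Ioo (0 : ℝ) 1) {S : A}
    (hS : star S * S = 1) :
    1 - discGenerator r S * star (discGenerator r S) = (1 - S * star S) +
      (r : ℂ) • (S * (1 - discGenerator r S * star (discGenerator r S)) * star S) := by
  have h := discGenerator_disc hr hS
  have h1 : discModulus r S = (1 : A) -
      (r : ℂ) • (1 - discGenerator r S * star (discGenerator r S)) := by
    rw [star_discGenerator_mul_self hr hS, sub_eq_iff_eq_add] at h
    rw [h, smul_sub, Complex.ofReal_sub, sub_smul]
    simp only [Complex.ofReal_one, one_smul]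
    abel
  conv_lhs => rw [discGenerator_mul_star_self hr, h1]
  rw [mul_sub, sub_mul, mul_smul_comm, smul_mul_assoc, mul_one]
  abel

theorem IsSphereIsometryPair.isQuantumSpherePair
    (hp : p ∈ Set.Ioo (0 : ℝ) 1) (hq : q ∈ Set.Ioo (0 : ℝ) 1) {V : Fin 2 → A}
    (h : IsSphereIsometryPair V) :
    IsQuantumSpherePair p q (discGenerator q (V 0)) (discGenerator p (V 1)) := by
  have i0 := h.isometry 0
  have i1 := h.isometry 1
  have n : (0 : Fin 2) ≠ 1 := by decide
  have k1 : Commute (V 0) (V 1) := h.comm 0 1 n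
  have k2 : Commute (star (V 0)) (V 1) := h.star_comm 0 1 n
  have k3 : Commute (V 0) (star (V 1)) := (h.star_comm 1 0 n.symm).symm
  have k4 : Commute (star (V 0)) (star (V 1)) := k1.star_star
  have c1 : Commute (V 0) (discGenerator p (V 1)) := commute_discGenerator hp i1 k1 k3
  have c2 : Commute (star (V 0)) (discGenerator p (V 1)) := commute_discGenerator hp i1 k2 k4
  have d1 : Commute (discGenerator q (V 0)) (discGenerator p (V 1)) :=
    (commute_discGenerator hq i0 c1.symm c2.symm).symm
  have d2 : Commute (star (discGenerator p (V 1))) (discGenerator q (V 0)) :=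
    commute_discGenerator hq i0 (by simpa using c2.star_star.symm) c1.star_star.symm
  have d3 : Commute (star (discGenerator q (V 0))) (discGenerator p (V 1)) := by
    simpa using d2.star_star.symm
  refine ⟨d1, d2.symm, d1.star_star, d3, discGenerator_disc hq i0, discGenerator_disc hp i1, ?_⟩
  have hx := one_sub_discGenerator_mul_star hq i0
  have hy := one_sub_discGenerator_mul_star hp i1
  have c3 : Commute (1 - discGenerator p (V 1) * star (discGenerator p (V 1))) (star (V 0)) :=
    (Commute.one_left _).sub_left (c2.symm.mul_left (by simpa using c1.star_star.symm))
  set x := 1 - discGenerator q (V 0) * star (discGenerator q (V 0))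
  set y := 1 - discGenerator p (V 1) * star (discGenerator p (V 1))
  -- With `x = P + q S x S⋆` and `y = Q + p T y T⋆`, the relation `PQ = 0` makes `Py`, and then
  -- `xy`, a fixed point of a strict contraction.
  have hPy : (1 - V 0 * star (V 0)) * y = 0 := by
    refine eq_zero_of_eq_smul_conj hp i1 ?_
    have c4 : Commute (1 - V 0 * star (V 0)) (V 1) :=
      (Commute.one_left _).sub_left (k1.mul_left k2)
    conv_lhs => rw [hy, mul_add, h.defect 0 1 n, zero_add, mul_smul_comm]
    simp only [← mul_assoc, c4.eq]
  refine eq_zero_of_eq_smul_conj hq i0 ?_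
  conv_lhs => rw [hx, add_mul, hPy, zero_add, smul_mul_assoc]
  simp only [mul_assoc, c3.eq]

end

/-! ### The 2-graph -/

/-- The action of `ℕ²` on the three vertices: `none` is fixed, and `some i` is moved to `none` by
every `d` with `d i ≠ 0` and fixed by the others. -/
def sphereShift (d : Fin 2 → ℕ) : Option (Fin 2) → Option (Fin 2)
  | none => none
  | some i => if d i = 0 then some i else none

@[simp] theorem sphereShift_none (d : Fin 2 → ℕ) : sphereShift d none = none := rfl

theorem sphereShift_some (d : Fin 2 → ℕ) (i : Fin 2) :
    sphereShift d (some i) = if d i = 0 then some i else none := rfl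

@[simp] theorem sphereShift_zero (u : Option (Fin 2)) : sphereShift 0 u = u := by
  cases u <;> simp [sphereShift]

theorem sphereShift_add (m n : Fin 2 → ℕ) (u : Option (Fin 2)) :
    sphereShift (m + n) u = sphereShift m (sphereShift n u) := by
  rcases u with _ | i
  · rfl
  · by_cases h : n i = 0 <;> simp [sphereShift, h]

@[simp] theorem sphereShift_single_self (i : Fin 2) :
    sphereShift (Pi.single i 1) (some i) = none := by
  simp [sphereShift]

theorem sphereShift_single_of_ne {i j : Fin 2} (h : j ≠ i) :
    sphereShift (Pi.single i 1) (some j) = some j := by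
  simp [sphereShift, h]

/-- The 2-graph of the quantum sphere: the action category of `ℕ²` on its three vertices. A path
from `u` to `v` is a degree `d` that moves `u` to `v`. -/
def sphereGraph : HigherRankGraph 2 where
  Obj := Option (Fin 2)
  category :=
    { Hom := fun u v => {d : Fin 2 → ℕ // sphereShift d u = v}
      id := fun u => ⟨0, sphereShift_zero u⟩
      comp := fun f g => ⟨g.1 + f.1, by rw [sphereShift_add, f.2, g.2]⟩
      id_comp := fun _ => Subtype.ext (add_zero _)
      comp_id := fun _ => Subtype.ext (zero_add _)
      assoc := fun _ _ _ => Subtype.ext (add_assoc _ _ _).symm }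
  countable_hom _ _ := Subtype.countable
  deg f := f.1
  deg_id _ := rfl
  deg_comp _ _ := rfl
  factorization {u w} h m n hd := by
    refine ⟨⟨sphereShift n u, ⟨n, rfl⟩, ⟨m, ?_⟩⟩, ⟨rfl, rfl, Subtype.ext hd.symm⟩, ?_⟩
    · rw [← sphereShift_add, ← hd]
      exact h.2
    · rintro ⟨v, ⟨d₁, rfl⟩, ⟨d₂, h₂⟩⟩ ⟨rfl, rfl, -⟩
      rfl

namespace sphereGraph

/-- The path with source `u` and degree `d`. -/
def path (u : Option (Fin 2)) (d : Fin 2 → ℕ) {v : Option (Fin 2)} (h : sphereShift d u = v) :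
    @Quiver.Hom sphereGraph.Obj _ u v :=
  ⟨d, h⟩

/-- The degree of a path with range `v`, as a function on the type of all such paths. -/
def pathDegree {v : sphereGraph.Obj} (x : (u : sphereGraph.Obj) × (u ⟶ v)) : Fin 2 → ℕ :=
  sphereGraph.deg x.2

theorem ext_pathsTo {v : sphereGraph.Obj} {x y : (u : sphereGraph.Obj) × (u ⟶ v)}
    (h₁ : x.1 = y.1) (h₂ : pathDegree x = pathDegree y) : x = y := by
  obtain ⟨u, d, hd⟩ := x
  obtain ⟨u', d', hd'⟩ := y
  obtain rfl : u = u' := h₁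
  obtain rfl : d = d' := h₂
  rfl

theorem pathsTo_single_eq_empty_iff (u : Option (Fin 2)) (i : Fin 2) :
    sphereGraph.pathsTo u (Pi.single i 1) = ∅ ↔ u = some i := by
  constructor
  · intro h
    by_contra hu
    refine Set.eq_empty_iff_forall_notMem.1 h ⟨u, path u (Pi.single i 1) ?_⟩ rfl
    rcases u with _ | j
    · rfl
    · exact sphereShift_single_of_ne fun hj => hu (congrArg some hj)
  · rintro rfl
    refine Set.eq_empty_iff_forall_notMem.2 ?_
    rintro ⟨u, d, hd⟩ (rfl : d = _)
    rcases u with _ | j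
    · cases hd
    · by_cases hj : j = i
      · subst hj
        rw [sphereShift_single_self] at hd
        cases hd
      · rw [sphereShift_single_of_ne hj] at hd
        exact hj (Option.some.inj hd)

theorem single_add_le_iff {d n : Fin 2 → ℕ} (h : d ≤ n) (i : Fin 2) :
    d + Pi.single i 1 ≤ n ↔ d i < n i := by
  constructor
  · intro h'
    simpa using h' i
  · intro h' j
    by_cases hj : j = i
    · subst hj
      simpa using h'
    · simpa [hj] using h j

theorem mem_pathsToLE_iff {v u : Option (Fin 2)} {n d : Fin 2 → ℕ} (h : sphereShift d u = v) :
    (⟨u, path u d h⟩ : (u : sphereGraph.Obj) × (u ⟶ v)) ∈ sphereGraph.pathsToLE v n ↔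
      d ≤ n ∧ ∀ i, d i < n i → u = some i := by
  refine and_congr_right fun hd => forall_congr' fun i => ?_
  exact imp_congr (single_add_le_iff hd i) (pathsTo_single_eq_empty_iff u i)

theorem rowFinite : sphereGraph.RowFinite := by
  intro v n
  have : Finite sphereGraph.Obj := inferInstanceAs (Finite (Option (Fin 2)))
  exact Set.Finite.of_injOn (f := Sigma.fst) (t := Set.univ) (fun _ _ => trivial)
    (fun x hx y hy h => ext_pathsTo h (Eq.trans hx (Eq.symm hy))) Set.finite_univ

theorem locallyConvex : sphereGraph.LocallyConvex := by
  rintro v i j hij ⟨u, d, rfl⟩ (rfl : d = _) h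
  refine Set.nonempty_iff_ne_empty.2 fun hu => ?_
  obtain rfl : u = some j := (pathsTo_single_eq_empty_iff u j).1 hu
  exact h.ne_empty ((pathsTo_single_eq_empty_iff _ j).2 (sphereShift_single_of_ne hij.symm))

/-- The vertex `some i` receives no edge of colour `i`, and one loop of the other colour. -/
theorem pathsToLE_some (i : Fin 2) (n : Fin 2 → ℕ) :
    sphereGraph.pathsToLE (some i) n =
      {⟨some i, path (some i) (Function.update n i 0) (by simp [sphereShift])⟩} := by
  ext ⟨u, d, hd⟩
  refine (mem_pathsToLE_iff hd).trans ?_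
  constructor
  · rintro ⟨h1, h2⟩
    rcases u with _ | j
    · cases hd
    · obtain ⟨h0, rfl⟩ : d j = 0 ∧ j = i := by
        rw [sphereShift_some] at hd
        split_ifs at hd with h
        exact ⟨h, Option.some.inj hd⟩
      obtain rfl : d = Function.update n j 0 := by
        ext l
        by_cases hl : l = j
        · subst hl
          simpa using h0
        · rw [Function.update_of_ne hl]
          by_contra hne
          exact hl (Option.some.inj (h2 l (lt_of_le_of_ne (h1 l) hne))).symm
      rfl
  · intro h
    obtain rfl : u = some i := congrArg Sigma.fst h
    obtain rfl : d = Function.update n i 0 := congrArg pathDegree h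
    refine ⟨update_le_iff.2 ⟨Nat.zero_le _, fun _ _ => le_rfl⟩, fun l hl => ?_⟩
    by_contra hne
    rw [Function.update_of_ne fun h => hne (congrArg some h.symm)] at hl
    exact lt_irrefl _ hl

/-- The paths to `none` counted by the Cuntz–Krieger relation of degree `n`: from `none`, the path
of degree `n`; from `some i`, the paths whose degree agrees with `n` except that its `i`-th entry
is any of `1, …, n i`. -/
theorem pathsToLE_none (n : Fin 2 → ℕ) :
    sphereGraph.pathsToLE none n =
      insert ⟨none, path none n rfl⟩ (⋃ i : Fin 2, (fun j : ℕ =>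
        ⟨some i, path (some i) (Function.update n i (j + 1)) (by simp [sphereShift])⟩) ''
          (Finset.range (n i) : Set ℕ)) := by
  ext ⟨u, d, hd⟩
  refine (mem_pathsToLE_iff hd).trans ?_
  rw [Set.mem_insert_iff, Set.mem_iUnion]
  constructor
  · rintro ⟨h1, h2⟩
    rcases u with _ | i
    · left
      obtain rfl : d = n := by
        ext l
        by_contra hne
        cases h2 l (lt_of_le_of_ne (h1 l) hne)
      rfl
    · right
      have h0 : d i ≠ 0 := fun h0 => by simp [sphereShift, h0] at hd
      refine ⟨i, d i - 1, ?_, ?_⟩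
      · have : d i ≤ n i := h1 i
        simp only [Finset.coe_range, Set.mem_Iio]
        omega
      · refine ext_pathsTo rfl (Eq.symm (?_ : d = Function.update n i (d i - 1 + 1)))
        ext l
        by_cases hl : l = i
        · subst hl
          simp only [Function.update_self]
          omega
        · rw [Function.update_of_ne hl]
          by_contra hne
          exact hl (Option.some.inj (h2 l (lt_of_le_of_ne (h1 l) hne))).symm
  · rintro (h | ⟨i, j, hj, h⟩)
    · obtain rfl : u = none := congrArg Sigma.fst h
      obtain rfl : d = n := congrArg pathDegree h
      exact ⟨le_rfl, fun i hi => (lt_irrefl _ hi).elim⟩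
    · obtain rfl : some i = u := congrArg Sigma.fst h
      obtain rfl : Function.update n i (j + 1) = d := congrArg pathDegree h
      have hj' : j < n i := by simpa using hj
      refine ⟨update_le_iff.2 ⟨hj', fun _ _ => le_rfl⟩, fun l hl => ?_⟩
      by_contra hne
      rw [Function.update_of_ne fun h => hne (congrArg some h.symm)] at hl
      exact lt_irrefl _ hl

theorem finsum_pathsToLE_none {M : Type*} [AddCommMonoid M] (n : Fin 2 → ℕ)
    (F : Option (Fin 2) → (Fin 2 → ℕ) → M) :
    ∑ᶠ x ∈ sphereGraph.pathsToLE none n, F x.1 (sphereGraph.deg x.2) =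
      F none n + ∑ i : Fin 2, ∑ j ∈ Finset.range (n i),
        F (some i) (Function.update n i (j + 1)) := by
  rw [pathsToLE_none, finsum_mem_insert]
  · congr 1
    rw [finsum_mem_iUnion, finsum_eq_sum_of_fintype]
    · refine Finset.sum_congr rfl fun i _ => ?_
      rw [finsum_mem_image, finsum_mem_coe_finset]
      · rfl
      · intro j _ j' _ h
        have h' : Function.update n i (j + 1) = Function.update n i (j' + 1) :=
          congrArg pathDegree h
        simpa using congrFun h' i
    · intro i i' hi
      refine Set.disjoint_left.2 ?_
      rintro _ ⟨j, -, rfl⟩ ⟨j', -, h⟩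
      exact hi (Option.some.inj (congrArg Sigma.fst h)).symm
    · exact fun i => (Finset.finite_toSet _).image _
  · rintro h
    obtain ⟨i, j, -, h⟩ := Set.mem_iUnion.1 h
    cases congrArg Sigma.fst h
  · exact Set.finite_iUnion fun i => (Finset.finite_toSet _).image _

end sphereGraph

/-! ### The Cuntz–Krieger family of a pair of isometries -/

section

variable {A : Type*} [Ring A] [StarRing A]

/-- The product of powers of the isometries with exponent vector `d`. -/
def sphereMonomial (V : Fin 2 → A) (d : Fin 2 → ℕ) : A := V 0 ^ d 0 * V 1 ^ d 1

/-- The vertex projections: the defect projection of `V i` at `some i`, and the complement of both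
defect projections at `none`. -/
def sphereVertexProj (V : Fin 2 → A) : Option (Fin 2) → A
  | none => 1 - (1 - V 0 * star (V 0)) - (1 - V 1 * star (V 1))
  | some i => 1 - V i * star (V i)

/-- The Cuntz–Krieger family built of a pair of isometries: the path with source `u` and degree `d`
is sent to `V^d P_u`. -/
def sphereFamily (V : Fin 2 → A) {u v : sphereGraph.Obj} (f : u ⟶ v) : A :=
  sphereMonomial V (sphereGraph.deg f) * sphereVertexProj V u

theorem sphereVertexProj_none (V : Fin 2 → A) :
    sphereVertexProj V none = 1 - sphereVertexProj V (some 0) - sphereVertexProj V (some 1) :=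
  rfl

namespace IsSphereIsometryPair

variable {V : Fin 2 → A} (h : IsSphereIsometryPair V)
include h

theorem commute_defect {i j : Fin 2} (hij : i ≠ j) : Commute (V i) (1 - V j * star (V j)) :=
  (Commute.one_right _).sub_right
    ((h.comm i j hij).mul_right (h.star_comm j i hij.symm).symm)

theorem star_pow_mul_pow (i : Fin 2) (n : ℕ) : star (V i) ^ n * V i ^ n = 1 := by
  induction n with
  | zero => simp
  | succ n ih =>
    rw [pow_succ, pow_succ', mul_assoc, ← mul_assoc (star (V i)) (V i), h.isometry, one_mul, ih]

theorem defect_mul (i : Fin 2) : (1 - V i * star (V i)) * V i = 0 := by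
  rw [sub_mul, mul_assoc, h.isometry, one_mul, mul_one, sub_self]

theorem isStarProjection_defect (i : Fin 2) : IsStarProjection (1 - V i * star (V i)) where
  isIdempotentElem := by
    rw [IsIdempotentElem, mul_sub, ← mul_assoc, h.defect_mul, zero_mul, sub_zero, mul_one]
  isSelfAdjoint := by simp [IsSelfAdjoint]

theorem orthogonal_vertexProj {u v : Option (Fin 2)} (huv : u ≠ v) :
    sphereVertexProj V u * sphereVertexProj V v = 0 := by
  have h0 : sphereVertexProj V (some 0) * sphereVertexProj V (some 0) =
    sphereVertexProj V (some 0) := (h.isStarProjection_defect 0).isIdempotentElem.eq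
  have h1 : sphereVertexProj V (some 1) * sphereVertexProj V (some 1) =
    sphereVertexProj V (some 1) := (h.isStarProjection_defect 1).isIdempotentElem.eq
  have h01 : sphereVertexProj V (some 0) * sphereVertexProj V (some 1) = 0 :=
    h.defect 0 1 (by decide)
  have h10 : sphereVertexProj V (some 1) * sphereVertexProj V (some 0) = 0 :=
    h.defect 1 0 (by decide)
  rcases u with _ | i <;> rcases v with _ | j
  · exact (huv rfl).elim
  · fin_cases j <;> simp [sphereVertexProj_none, sub_mul, h0, h1, h01, h10]
  · fin_cases i <;> simp [sphereVertexProj_none, mul_sub, h0, h1, h01, h10]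
  · exact h.defect i j fun hij => huv (congrArg some hij)

theorem isStarProjection_vertexProj (u : Option (Fin 2)) :
    IsStarProjection (sphereVertexProj V u) := by
  rcases u with _ | i
  · refine ⟨?_, ?_⟩
    · have h0 := h.orthogonal_vertexProj (u := some 0) (v := none) (by simp)
      have h1 := h.orthogonal_vertexProj (u := some 1) (v := none) (by simp)
      rw [IsIdempotentElem]
      conv_lhs => enter [1]; rw [sphereVertexProj_none]
      rw [sub_mul, sub_mul, h0, h1, sub_zero, sub_zero, one_mul]
    · simp [IsSelfAdjoint, sphereVertexProj]
  · exact h.isStarProjection_defect i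

/-- An isometry maps the range of the projection at `u` into that of the projection at the shifted
vertex. -/
theorem vertexProj_mul_mul (i : Fin 2) (u : Option (Fin 2)) :
    sphereVertexProj V (sphereShift (Pi.single i 1) u) * (V i * sphereVertexProj V u) =
      V i * sphereVertexProj V u := by
  obtain ⟨j, hj⟩ : ∃ j : Fin 2, i ≠ j := ⟨i + 1, by fin_cases i <;> decide⟩
  have hnone : sphereVertexProj V none = 1 - (1 - V i * star (V i)) - (1 - V j * star (V j)) := by
    fin_cases i <;> fin_cases j <;> first | exact (hj rfl).elim | rfl | exact sub_right_comm _ _ _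
  have hjV : (1 - V j * star (V j)) * V i = V i * (1 - V j * star (V j)) :=
    (h.commute_defect hj).symm.eq
  have hidem := (h.isStarProjection_vertexProj u).isIdempotentElem.eq
  have key : sphereVertexProj V none * V i = V i * (1 - (1 - V j * star (V j))) := by
    rw [hnone, sub_mul, sub_mul, h.defect_mul, one_mul, hjV, sub_zero,
      mul_sub (V i) 1 (1 - _), mul_one]
  rcases u with _ | l
  · have h2 : (1 - V j * star (V j)) * sphereVertexProj V none = 0 :=
      h.orthogonal_vertexProj (u := some j) (by simp)
    rw [sphereShift_none, ← mul_assoc, key, mul_assoc, sub_mul, h2, sub_zero, one_mul]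
  · by_cases hl : l = i
    · subst hl
      have h2 : (1 - V j * star (V j)) * sphereVertexProj V (some l) = 0 :=
        h.defect j l hj.symm
      rw [sphereShift_single_self, ← mul_assoc, key, mul_assoc, sub_mul, h2, sub_zero, one_mul]
    · rw [sphereShift_single_of_ne hl, ← mul_assoc]
      have : sphereVertexProj V (some l) * V i = V i * sphereVertexProj V (some l) :=
        (h.commute_defect (Ne.symm hl)).symm.eq
      rw [this, mul_assoc, hidem]

theorem vertexProj_mul_pow_mul (i : Fin 2) (n : ℕ) (u : Option (Fin 2)) :
    sphereVertexProj V (sphereShift (n • Pi.single i 1) u) * (V i ^ n * sphereVertexProj V u) =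
      V i ^ n * sphereVertexProj V u := by
  induction n with
  | zero => simpa using (h.isStarProjection_vertexProj u).isIdempotentElem.eq
  | succ n ih =>
    rw [succ_nsmul', sphereShift_add, pow_succ', mul_assoc, ← ih, ← mul_assoc (V i), ← mul_assoc,
      h.vertexProj_mul_mul]

theorem vertexProj_mul_monomial_mul (d : Fin 2 → ℕ) (u : Option (Fin 2)) :
    sphereVertexProj V (sphereShift d u) * (sphereMonomial V d * sphereVertexProj V u) =
      sphereMonomial V d * sphereVertexProj V u := by
  have hd : d = d 0 • Pi.single 0 1 + d 1 • Pi.single 1 1 := by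
    ext i
    fin_cases i <;> simp
  conv_lhs => enter [1, 2]; rw [hd, sphereShift_add]
  rw [sphereMonomial, mul_assoc, ← h.vertexProj_mul_pow_mul 1, ← mul_assoc (V 0 ^ _),
    ← mul_assoc, h.vertexProj_mul_pow_mul 0]

theorem monomial_add (m n : Fin 2 → ℕ) :
    sphereMonomial V (m + n) = sphereMonomial V m * sphereMonomial V n := by
  have hc : V 0 ^ n 0 * V 1 ^ m 1 = V 1 ^ m 1 * V 0 ^ n 0 :=
    ((h.comm 0 1 (by decide)).pow_pow _ _).eq
  simp only [sphereMonomial, Pi.add_apply, pow_add]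
  rw [mul_assoc, ← mul_assoc (V 0 ^ n 0), hc]
  simp only [mul_assoc]

theorem star_monomial_mul_self (d : Fin 2 → ℕ) :
    star (sphereMonomial V d) * sphereMonomial V d = 1 := by
  rw [sphereMonomial, star_mul, star_pow, star_pow, mul_assoc, ← mul_assoc _ (V 0 ^ _),
    h.star_pow_mul_pow, one_mul, h.star_pow_mul_pow]

/-- The defect projection of `V j` commutes with `V i` and, by orthogonality of the defects, lies below
its range projection; so conjugation by powers of `V i` fixes it. -/
theorem pow_mul_defect_mul {i j : Fin 2} (hij : i ≠ j) (n : ℕ) :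
    V i ^ n * (1 - V j * star (V j)) * star (V i) ^ n = 1 - V j * star (V j) := by
  induction n with
  | zero => simp
  | succ n ih =>
    have h1 : (1 - V j * star (V j)) * (V i * star (V i)) = 1 - V j * star (V j) := by
      have := h.defect j i hij.symm
      rwa [mul_sub, mul_one, sub_eq_zero, eq_comm] at this
    have h2 : V i * (1 - V j * star (V j)) * star (V i) = 1 - V j * star (V j) := by
      rw [(h.commute_defect hij).eq, mul_assoc, h1]
    rw [pow_succ, pow_succ']
    calc _ = V i ^ n * (V i * (1 - V j * star (V j)) * star (V i)) * star (V i) ^ n := by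
          simp only [mul_assoc]
      _ = _ := by rw [h2, ih]

/-- The range projection of a path that starts at `some i` is a difference of consecutive range
projections of powers of `V i`, so that sums of these telescope. -/
theorem range_some (i : Fin 2) (d : Fin 2 → ℕ) :
    sphereMonomial V d * sphereVertexProj V (some i) * star (sphereMonomial V d) =
      V i ^ d i * star (V i) ^ d i - V i ^ (d i + 1) * star (V i) ^ (d i + 1) := by
  have e : V i ^ d i * star (V i) ^ d i - V i ^ (d i + 1) * star (V i) ^ (d i + 1) =
      V i ^ d i * (1 - V i * star (V i)) * star (V i) ^ d i := by
    rw [mul_sub, sub_mul, mul_one, pow_succ, pow_succ']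
    simp only [mul_assoc]
  rw [e]
  have hc : sphereMonomial V d = V 1 ^ d 1 * V 0 ^ d 0 :=
    ((h.comm 0 1 (by decide)).pow_pow _ _).eq
  fin_cases i
  · rw [hc, star_mul, star_pow, star_pow]
    calc _ = V 1 ^ d 1 * (V 0 ^ d 0 * (1 - V 0 * star (V 0)) * star (V 0) ^ d 0) *
          star (V 1) ^ d 1 := by simp only [sphereVertexProj, Fin.zero_eta, mul_assoc]
      _ = V 0 ^ d 0 * (V 1 ^ d 1 * (1 - V 0 * star (V 0)) * star (V 1) ^ d 1) *
          star (V 0) ^ d 0 := by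
        have c1 : V 1 ^ d 1 * V 0 ^ d 0 = V 0 ^ d 0 * V 1 ^ d 1 :=
          ((h.comm 1 0 (by decide)).pow_pow _ _).eq
        have c2 : star (V 0) ^ d 0 * star (V 1) ^ d 1 = star (V 1) ^ d 1 * star (V 0) ^ d 0 :=
          ((h.comm 0 1 (by decide)).star_star.pow_pow _ _).eq
        simp only [mul_assoc, c2]
        rw [← mul_assoc (V 1 ^ _), c1, mul_assoc]
      _ = _ := by rw [h.pow_mul_defect_mul (by decide)]; rfl
  · rw [sphereMonomial, star_mul, star_pow, star_pow]
    calc _ = V 0 ^ d 0 * (V 1 ^ d 1 * (1 - V 1 * star (V 1)) * star (V 1) ^ d 1) *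
          star (V 0) ^ d 0 := by simp only [sphereVertexProj, Fin.mk_one, mul_assoc]
      _ = V 1 ^ d 1 * (V 0 ^ d 0 * (1 - V 1 * star (V 1)) * star (V 0) ^ d 0) *
          star (V 1) ^ d 1 := by
        have c1 : V 0 ^ d 0 * V 1 ^ d 1 = V 1 ^ d 1 * V 0 ^ d 0 :=
          ((h.comm 0 1 (by decide)).pow_pow _ _).eq
        have c2 : star (V 1) ^ d 1 * star (V 0) ^ d 0 = star (V 0) ^ d 0 * star (V 1) ^ d 1 :=
          ((h.comm 1 0 (by decide)).star_star.pow_pow _ _).eq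
        simp only [mul_assoc, c2]
        rw [← mul_assoc (V 0 ^ _), c1, mul_assoc]
      _ = _ := by rw [h.pow_mul_defect_mul (by decide)]; rfl

theorem one_sub_pow_mul_one_sub_pow (m n : ℕ) :
    (1 - V 0 ^ m * star (V 0) ^ m) * (1 - V 1 ^ n * star (V 1) ^ n) = 0 := by
  have c1 : Commute (star (V 0)) (1 - V 1 ^ n * star (V 1) ^ n) :=
    (Commute.one_right _).sub_right (((h.star_comm 0 1 (by decide)).pow_right n).mul_right
      ((h.comm 0 1 (by decide)).star_star.pow_right n))
  induction m with
  | zero => simp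
  | succ m ih =>
    have e : 1 - V 0 ^ (m + 1) * star (V 0) ^ (m + 1) =
        (1 - V 0 * star (V 0)) + V 0 * (1 - V 0 ^ m * star (V 0) ^ m) * star (V 0) := by
      rw [mul_sub, sub_mul, mul_one, pow_succ' (V 0), pow_succ (star (V 0))]
      simp only [mul_assoc]
      abel
    have h0 : (1 - V 0 * star (V 0)) * (1 - V 1 ^ n * star (V 1) ^ n) = 0 := by
      have h1 := h.pow_mul_defect_mul (i := 1) (j := 0) (by decide) n
      rw [((h.commute_defect (i := 1) (j := 0) (by decide)).pow_left n).eq, mul_assoc] at h1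
      rw [mul_sub, mul_one, h1, sub_self]
    rw [e, add_mul, h0, zero_add, mul_assoc, c1.eq, mul_assoc, ← mul_assoc (1 - _), ih, zero_mul,
      mul_zero]

theorem range_none (n : Fin 2 → ℕ) :
    sphereMonomial V n * sphereVertexProj V none * star (sphereMonomial V n) =
      V 0 ^ (n 0 + 1) * star (V 0) ^ (n 0 + 1) + V 1 ^ (n 1 + 1) * star (V 1) ^ (n 1 + 1) - 1 := by
  have e : sphereMonomial V n * star (sphereMonomial V n) =
      (V 0 ^ n 0 * star (V 0) ^ n 0) * (V 1 ^ n 1 * star (V 1) ^ n 1) := by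
    have c : V 1 ^ n 1 * star (V 1) ^ n 1 * star (V 0) ^ n 0 =
        star (V 0) ^ n 0 * (V 1 ^ n 1 * star (V 1) ^ n 1) :=
      (((h.star_comm 0 1 (by decide)).pow_pow _ _).mul_right
        ((h.comm 0 1 (by decide)).star_star.pow_pow _ _)).eq.symm
    rw [sphereMonomial, star_mul, star_pow, star_pow]
    rw [mul_assoc, ← mul_assoc (V 1 ^ _), c, mul_assoc]
  have h0 := h.one_sub_pow_mul_one_sub_pow (n 0) (n 1)
  rw [sub_mul, one_mul, mul_sub, mul_one] at h0
  rw [sphereVertexProj_none, mul_sub, mul_sub, sub_mul, sub_mul, mul_one, h.range_some,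
    h.range_some, e]
  rw [← sub_eq_zero, ← h0]
  abel

/-- The Cuntz–Krieger relation at `none` holds because the range projections of the paths from
`some 0` and `some 1` telescope and cancel against `range_none`. -/
theorem isCuntzKriegerFamily_sphereFamily :
    sphereGraph.IsCuntzKriegerFamily (fun {_ _} f => sphereFamily V f) where
  isStarProjection v := by
    simpa [sphereFamily, sphereGraph.deg_id, sphereMonomial] using h.isStarProjection_vertexProj v
  orthogonal v w hvw := by
    simpa [sphereFamily, sphereGraph.deg_id, sphereMonomial] using h.orthogonal_vertexProj hvw
  comp {u v w} f g := by
    rw [sphereFamily, sphereFamily, sphereFamily, sphereGraph.deg_comp, h.monomial_add, mul_assoc,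
      mul_assoc]
    obtain ⟨d, rfl⟩ := f
    exact congrArg _ (h.vertexProj_mul_monomial_mul d u).symm
  star_mul_self {u v} f := by
    have hp := h.isStarProjection_vertexProj u
    rw [sphereFamily, star_mul, mul_assoc, ← mul_assoc _ (sphereMonomial V _),
      h.star_monomial_mul_self, one_mul, hp.isSelfAdjoint.star_eq]
    simpa [sphereFamily, sphereGraph.deg_id, sphereMonomial] using hp.isIdempotentElem.eq
  sum_eq v n := by
    have e : ∀ x : (u : sphereGraph.Obj) × (u ⟶ v),
        sphereFamily V x.2 * star (sphereFamily V x.2) =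
          sphereMonomial V (sphereGraph.deg x.2) * sphereVertexProj V x.1 *
            star (sphereMonomial V (sphereGraph.deg x.2)) := fun x => by
      have hp := h.isStarProjection_vertexProj x.1
      rw [sphereFamily, star_mul, hp.isSelfAdjoint.star_eq, mul_assoc, ← mul_assoc _ _ (star _),
        hp.isIdempotentElem.eq, mul_assoc]
    have e0 : sphereFamily V (𝟙 v) = sphereVertexProj V v := by
      simp [sphereFamily, sphereGraph.deg_id, sphereMonomial]
    simp only [e, e0]
    rcases v with _ | i
    · refine Eq.trans ?_ (sphereGraph.finsum_pathsToLE_none n fun u d =>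
        sphereMonomial V d * sphereVertexProj V u * star (sphereMonomial V d)).symm
      simp only [h.range_none, h.range_some, Function.update_self]
      rw [Fin.sum_univ_two,
        Finset.sum_range_sub' (fun j => V 0 ^ (j + 1) * star (V 0) ^ (j + 1)),
        Finset.sum_range_sub' (fun j => V 1 ^ (j + 1) * star (V 1) ^ (j + 1)),
        sphereVertexProj_none]
      simp only [zero_add, pow_one, sphereVertexProj]
      abel
    · rw [sphereGraph.pathsToLE_some, finsum_mem_singleton]
      refine Eq.trans ?_ (h.range_some i (Function.update n i 0)).symm
      simp [sphereVertexProj]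

end IsSphereIsometryPair
end

/-! ### The pair of isometries of a Cuntz–Krieger family -/

theorem HigherRankGraph.IsCuntzKriegerFamily.map {k : ℕ} {Λ : HigherRankGraph k}
    (hΛ : Λ.RowFinite) {B C : Type*} [NonUnitalRing B] [StarRing B] [Module ℂ B]
    [NonUnitalRing C] [StarRing C] [Module ℂ C]
    {s : ∀ {u v : Λ.Obj}, (u ⟶ v) → B} (hs : Λ.IsCuntzKriegerFamily s) (φ : B →⋆ₙₐ[ℂ] C) :
    Λ.IsCuntzKriegerFamily (fun {_ _} f => φ (s f)) where
  isStarProjection v := (hs.isStarProjection v).map φ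
  orthogonal v w hvw := by rw [← map_mul, hs.orthogonal v w hvw, map_zero]
  comp f g := by rw [hs.comp, map_mul]
  star_mul_self f := by rw [← map_star, ← map_mul, hs.star_mul_self]
  sum_eq v n := by
    rw [hs.sum_eq v n, finsum_mem_eq_finite_toFinset_sum _ (hΛ.finite_pathsToLE v n),
      finsum_mem_eq_finite_toFinset_sum _ (hΛ.finite_pathsToLE v n), map_sum]
    simp only [map_mul, map_star]

namespace sphereGraph

section

variable {A : Type*} (s : ∀ {u v : sphereGraph.Obj}, (u ⟶ v) → A)

/-- The element of a family at the path with source `u` and degree `d`. -/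
def familyAt (u : Option (Fin 2)) (d : Fin 2 → ℕ) : A := s (path u d rfl)

variable {s} in
theorem eq_familyAt {u v : sphereGraph.Obj} (f : u ⟶ v) :
    s f = familyAt s u (sphereGraph.deg f) := by
  obtain ⟨d, rfl⟩ := f
  rfl

theorem family_id (u : Option (Fin 2)) :
    s (CategoryStruct.id (obj := sphereGraph.Obj) u) = familyAt s u 0 :=
  eq_familyAt (CategoryStruct.id (obj := sphereGraph.Obj) u)

variable [Ring A] [StarRing A]

/-- The sum of the vertex projections, which is a unit for the elements of the family. -/
def familyUnit : A := ∑ u : Option (Fin 2), familyAt s u 0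

/-- The sum of the elements of the family at all edges of colour `i`. -/
def familyEdgeSum (i : Fin 2) : A := ∑ u : Option (Fin 2), familyAt s u (Pi.single i 1)

/-- The sum of the edges of colour `i`, made into an isometry of the ambient unital algebra by
adding the complement of the unit of the family. -/
def familyIsometry (i : Fin 2) : A := familyEdgeSum s i + (1 - familyUnit s)

variable {s}

variable (hs : sphereGraph.IsCuntzKriegerFamily s)
include hs

theorem familyAt_add (u : Option (Fin 2)) (m n : Fin 2 → ℕ) :
    familyAt s u (m + n) = familyAt s (sphereShift n u) m * familyAt s u n := by
  refine Eq.trans ?_ (hs.comp (path u n rfl) (path (sphereShift n u) m rfl))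
  exact (eq_familyAt (s := s) (path u n rfl ≫ path (sphereShift n u) m rfl)).symm

theorem star_familyAt_zero (u : Option (Fin 2)) : star (familyAt s u 0) = familyAt s u 0 := by
  rw [← family_id s]
  exact (hs.isStarProjection u).isSelfAdjoint.star_eq

theorem familyAt_zero_mul_familyAt_zero {u v : Option (Fin 2)} (h : u ≠ v) :
    familyAt s u 0 * familyAt s v 0 = 0 := by
  rw [← family_id s, ← family_id s]
  exact hs.orthogonal u v h

theorem familyAt_mul_source (u : Option (Fin 2)) (d : Fin 2 → ℕ) :
    familyAt s u d * familyAt s u 0 = familyAt s u d := by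
  have := familyAt_add hs u d 0
  rwa [add_zero, sphereShift_zero, eq_comm] at this

theorem range_mul_familyAt (u : Option (Fin 2)) (d : Fin 2 → ℕ) :
    familyAt s (sphereShift d u) 0 * familyAt s u d = familyAt s u d := by
  have := familyAt_add hs u 0 d
  rwa [zero_add, eq_comm] at this

theorem star_familyAt_mul_self (u : Option (Fin 2)) (d : Fin 2 → ℕ) :
    star (familyAt s u d) * familyAt s u d = familyAt s u 0 := by
  rw [← family_id s]
  exact hs.star_mul_self (path u d rfl)

theorem familyAt_mul_of_ne {u v : Option (Fin 2)} (h : u ≠ v) (d : Fin 2 → ℕ) :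
    familyAt s u d * familyAt s v 0 = 0 := by
  rw [← familyAt_mul_source hs, mul_assoc, familyAt_zero_mul_familyAt_zero hs h, mul_zero]

theorem mul_familyAt_of_ne {u v : Option (Fin 2)} {d : Fin 2 → ℕ} (h : v ≠ sphereShift d u) :
    familyAt s v 0 * familyAt s u d = 0 := by
  rw [← range_mul_familyAt hs u, ← mul_assoc, familyAt_zero_mul_familyAt_zero hs h, zero_mul]

theorem familyEdgeSum_mul (i : Fin 2) (u : Option (Fin 2)) :
    familyEdgeSum s i * familyAt s u 0 = familyAt s u (Pi.single i 1) := by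
  rw [familyEdgeSum, Finset.sum_mul, Finset.sum_eq_single u
    (fun v _ hv => familyAt_mul_of_ne hs hv _) (by simp), familyAt_mul_source hs]

theorem familyUnit_mul (u : Option (Fin 2)) (d : Fin 2 → ℕ) :
    familyUnit s * familyAt s u d = familyAt s u d := by
  rw [familyUnit, Finset.sum_mul, Finset.sum_eq_single (sphereShift d u)
    (fun v _ hv => mul_familyAt_of_ne hs hv) (by simp), range_mul_familyAt hs]

theorem mul_familyUnit (u : Option (Fin 2)) (d : Fin 2 → ℕ) :
    familyAt s u d * familyUnit s = familyAt s u d := by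
  rw [familyUnit, Finset.mul_sum, Finset.sum_eq_single u
    (fun v _ hv => familyAt_mul_of_ne hs hv.symm _) (by simp), familyAt_mul_source hs]

theorem star_familyUnit : star (familyUnit s) = familyUnit s := by
  simp only [familyUnit, star_sum, star_familyAt_zero hs]

theorem familyUnit_mul_self : familyUnit s * familyUnit s = familyUnit s := by
  conv_lhs => enter [2]; rw [familyUnit]
  simp only [Finset.mul_sum, familyUnit_mul hs]
  rfl

theorem familyUnit_mul_edgeSum (i : Fin 2) :
    familyUnit s * familyEdgeSum s i = familyEdgeSum s i := by
  simp only [familyEdgeSum, Finset.mul_sum, familyUnit_mul hs]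

theorem edgeSum_mul_familyUnit (i : Fin 2) :
    familyEdgeSum s i * familyUnit s = familyEdgeSum s i := by
  simp only [familyEdgeSum, Finset.sum_mul, mul_familyUnit hs]

theorem edgeSum_mul_familyAt (i : Fin 2) (u : Option (Fin 2)) (d : Fin 2 → ℕ) :
    familyEdgeSum s i * familyAt s u d = familyAt s u (Pi.single i 1 + d) := by
  rw [← range_mul_familyAt hs, ← mul_assoc, familyEdgeSum_mul hs, familyAt_add hs]

theorem edgeSum_comm (i j : Fin 2) :
    familyEdgeSum s i * familyEdgeSum s j = familyEdgeSum s j * familyEdgeSum s i := by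
  conv_lhs => enter [2]; rw [familyEdgeSum]
  conv_rhs => enter [2]; rw [familyEdgeSum]
  simp only [Finset.mul_sum, edgeSum_mul_familyAt hs, add_comm (Pi.single i 1)]

theorem familyAt_some_eq {i j : Fin 2} (h : j ≠ i) :
    familyAt s (some j) 0 =
      familyAt s (some j) (Pi.single i 1) * star (familyAt s (some j) (Pi.single i 1)) := by
  refine (hs.sum_eq (some j) (Pi.single i 1)).trans ?_
  rw [pathsToLE_some, finsum_mem_singleton]
  rw [eq_familyAt (s := s) (path _ _ _)]
  have : Function.update (Pi.single i 1 : Fin 2 → ℕ) j 0 = Pi.single i 1 := by simp [h]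
  exact congrArg (fun d => familyAt s (some j) d * star (familyAt s (some j) d)) this

theorem familyAt_none_eq (i : Fin 2) :
    familyAt s none 0 =
      familyAt s none (Pi.single i 1) * star (familyAt s none (Pi.single i 1)) +
      familyAt s (some i) (Pi.single i 1) * star (familyAt s (some i) (Pi.single i 1)) := by
  have e : ∀ x : (u : sphereGraph.Obj) × (u ⟶ (none : Option (Fin 2))),
      s x.2 * star (s x.2) = familyAt s x.1 (sphereGraph.deg x.2) *
        star (familyAt s x.1 (sphereGraph.deg x.2)) := fun x => by
    rw [eq_familyAt (s := s) x.2]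
  refine (hs.sum_eq none (Pi.single i 1)).trans ?_
  refine (finsum_mem_congr rfl fun x _ => e x).trans ?_
  refine (finsum_pathsToLE_none (Pi.single i 1) fun u d =>
    familyAt s u d * star (familyAt s u d)).trans ?_
  congr 1
  rw [Finset.sum_eq_single i]
  · simp [Pi.single]
  · intro j _ hj
    simp [hj]
  · simp

/-- The two edges of one colour with the same range have orthogonal ranges, since their range
projections sum to a projection. -/
theorem star_edge_mul_edge_of_ne (i : Fin 2) {u v : Option (Fin 2)} (h : u ≠ v) :
    star (familyAt s u (Pi.single i 1)) * familyAt s v (Pi.single i 1) = 0 := by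
  have hne : ∀ {u v : Option (Fin 2)},
      sphereShift (Pi.single i 1) u ≠ sphereShift (Pi.single i 1) v →
      star (familyAt s u (Pi.single i 1)) * familyAt s v (Pi.single i 1) = 0 := by
    intro u v huv
    rw [← range_mul_familyAt hs v, ← mul_assoc, ← star_familyAt_zero hs, ← star_mul,
      mul_familyAt_of_ne hs huv.symm, star_zero, zero_mul]
  have hni : star (familyAt s none (Pi.single i 1)) * familyAt s (some i) (Pi.single i 1) = 0 := by
    have h1 := range_mul_familyAt hs (some i) (Pi.single i 1)
    rw [sphereShift_single_self, familyAt_none_eq hs i, add_mul, mul_assoc (familyAt s (some i) _),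
      star_familyAt_mul_self hs, familyAt_mul_source hs, add_eq_right] at h1
    have h2 := congrArg (star (familyAt s none (Pi.single i 1)) * ·) h1
    simp only [← mul_assoc, star_familyAt_mul_self hs, mul_zero] at h2
    rwa [← star_familyAt_zero hs, ← star_mul, familyAt_mul_source hs] at h2
  by_cases huv : sphereShift (Pi.single i 1) u = sphereShift (Pi.single i 1) v
  · have hin := congrArg star hni
    rw [star_mul, star_star, star_zero] at hin
    have cases : ∀ u : Option (Fin 2), u = none ∨ u = some i ∨
        (∃ j, u = some j ∧ sphereShift (Pi.single i 1) u = some j) := by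
      rintro (_ | j)
      · exact .inl rfl
      · by_cases hj : j = i
        · exact .inr (.inl (congrArg some hj))
        · exact .inr (.inr ⟨j, rfl, sphereShift_single_of_ne hj⟩)
    rcases cases u with rfl | rfl | ⟨j, rfl, hj⟩ <;>
      rcases cases v with rfl | rfl | ⟨l, rfl, hl⟩ <;>
      simp_all
  · exact hne huv

theorem star_edgeSum_mul_self (i : Fin 2) :
    star (familyEdgeSum s i) * familyEdgeSum s i = familyUnit s := by
  simp only [familyEdgeSum, star_sum, Finset.sum_mul, Finset.mul_sum, familyUnit]
  refine Finset.sum_congr rfl fun u _ => ?_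
  rw [Finset.sum_eq_single u (fun v _ hv => star_edge_mul_edge_of_ne hs i hv) (by simp),
    star_familyAt_mul_self hs]

theorem edgeSum_mul_star_self (i : Fin 2) :
    familyEdgeSum s i * star (familyEdgeSum s i) = familyUnit s - familyAt s (some i) 0 := by
  have h1 : familyEdgeSum s i * star (familyEdgeSum s i) =
      ∑ u : Option (Fin 2), familyAt s u (Pi.single i 1) * star (familyAt s u (Pi.single i 1)) := by
    conv_lhs => enter [2]; rw [familyEdgeSum]
    rw [star_sum, Finset.mul_sum]
    refine Finset.sum_congr rfl fun u _ => ?_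
    conv_lhs => rw [← familyAt_mul_source hs, star_mul, star_familyAt_zero hs, ← mul_assoc,
      familyEdgeSum_mul hs]
  obtain ⟨j, hj, hij⟩ : ∃ j : Fin 2, j ≠ i ∧ ∀ f : Fin 2 → A, ∑ l, f l = f i + f j := by
    refine ⟨i + 1, by fin_cases i <;> decide, fun f => ?_⟩
    fin_cases i <;> simp [add_comm]
  rw [h1, familyUnit, Fintype.sum_option, Fintype.sum_option, hij, hij, ← familyAt_some_eq hs hj,
    ← add_assoc, ← familyAt_none_eq hs i]
  abel

theorem vertex_mul_edgeSum (i : Fin 2) : familyAt s (some i) 0 * familyEdgeSum s i = 0 := by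
  rw [familyEdgeSum, Finset.mul_sum]
  refine Finset.sum_eq_zero fun u _ => mul_familyAt_of_ne hs ?_
  rcases u with _ | j
  · simp
  · by_cases hj : j = i
    · subst hj
      simp
    · rw [sphereShift_single_of_ne hj]
      exact fun h => hj (Option.some.inj h).symm

theorem star_edgeSum_comm {i j : Fin 2} (hij : i ≠ j) :
    star (familyEdgeSum s i) * familyEdgeSum s j =
      familyEdgeSum s j * star (familyEdgeSum s i) := by
  -- The edge of colour `j` that starts at `some i` is a loop, and the range of the edges of colour
  -- `i` is orthogonal to `some i`.
  have h1 : star (familyEdgeSum s i) * familyEdgeSum s j * familyAt s (some i) 0 = 0 := by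
    have h2 := range_mul_familyAt hs (some i) (Pi.single j 1)
    rw [sphereShift_single_of_ne hij] at h2
    rw [mul_assoc, familyEdgeSum_mul hs, ← h2, ← mul_assoc, ← star_familyAt_zero hs, ← star_mul,
      vertex_mul_edgeSum hs, star_zero, zero_mul]
  calc _ = star (familyEdgeSum s i) * familyEdgeSum s j *
        (familyEdgeSum s i * star (familyEdgeSum s i) + familyAt s (some i) 0) := by
        rw [edgeSum_mul_star_self hs, sub_add_cancel, mul_assoc, edgeSum_mul_familyUnit hs]
    _ = star (familyEdgeSum s i) * (familyEdgeSum s j * familyEdgeSum s i) *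
        star (familyEdgeSum s i) := by
        rw [mul_add, h1, add_zero]
        simp only [mul_assoc]
    _ = _ := by
        rw [edgeSum_comm hs, ← mul_assoc (star _), star_edgeSum_mul_self hs,
          familyUnit_mul_edgeSum hs]

theorem familyUnit_mul_star_edgeSum (i : Fin 2) :
    familyUnit s * star (familyEdgeSum s i) = star (familyEdgeSum s i) := by
  rw [← star_familyUnit hs, ← star_mul, edgeSum_mul_familyUnit hs]

theorem star_edgeSum_mul_familyUnit (i : Fin 2) :
    star (familyEdgeSum s i) * familyUnit s = star (familyEdgeSum s i) := by
  rw [← star_familyUnit hs, ← star_mul, familyUnit_mul_edgeSum hs]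

/-- Adding `1 - e` is multiplicative on the corner cut out by the unit `e` of the family. -/
theorem add_mul_add {x y : A} (hx : x * familyUnit s = x) (hy : familyUnit s * y = y) :
    (x + (1 - familyUnit s)) * (y + (1 - familyUnit s)) = x * y + (1 - familyUnit s) := by
  have h := familyUnit_mul_self hs
  simp only [add_mul, mul_add, mul_sub, sub_mul, hx, hy, h, mul_one, one_mul]
  abel

theorem star_familyIsometry (i : Fin 2) :
    star (familyIsometry s i) = star (familyEdgeSum s i) + (1 - familyUnit s) := by
  rw [familyIsometry, star_add, star_sub, star_one, star_familyUnit hs]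

theorem one_sub_familyIsometry_mul_star (i : Fin 2) :
    1 - familyIsometry s i * star (familyIsometry s i) = familyAt s (some i) 0 := by
  rw [star_familyIsometry hs, familyIsometry, add_mul_add hs (edgeSum_mul_familyUnit hs i)
    (familyUnit_mul_star_edgeSum hs i), edgeSum_mul_star_self hs]
  abel

theorem isSphereIsometryPair_familyIsometry : IsSphereIsometryPair (familyIsometry s) where
  isometry i := by
    rw [star_familyIsometry hs, familyIsometry, add_mul_add hs (star_edgeSum_mul_familyUnit hs i)
      (familyUnit_mul_edgeSum hs i), star_edgeSum_mul_self hs]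
    abel
  comm i j hij := by
    rw [Commute, SemiconjBy, familyIsometry, familyIsometry,
      add_mul_add hs (edgeSum_mul_familyUnit hs i) (familyUnit_mul_edgeSum hs j),
      add_mul_add hs (edgeSum_mul_familyUnit hs j) (familyUnit_mul_edgeSum hs i),
      edgeSum_comm hs]
  star_comm i j hij := by
    rw [Commute, SemiconjBy, star_familyIsometry hs, familyIsometry,
      add_mul_add hs (star_edgeSum_mul_familyUnit hs i) (familyUnit_mul_edgeSum hs j),
      add_mul_add hs (edgeSum_mul_familyUnit hs j) (familyUnit_mul_star_edgeSum hs i),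
      star_edgeSum_comm hs hij]
  defect i j hij := by
    rw [one_sub_familyIsometry_mul_star hs, one_sub_familyIsometry_mul_star hs]
    exact familyAt_zero_mul_familyAt_zero hs fun h => hij (Option.some.inj h)

theorem commute_familyUnit_familyIsometry (i : Fin 2) :
    Commute (familyUnit s) (familyIsometry s i) := by
  rw [Commute, SemiconjBy, familyIsometry, mul_add, add_mul, familyUnit_mul_edgeSum hs,
    edgeSum_mul_familyUnit hs, mul_sub, sub_mul, mul_one, one_mul]

theorem familyIsometry_pow_mul_familyAt (i : Fin 2) (n : ℕ) (u : Option (Fin 2))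
    (d : Fin 2 → ℕ) :
    familyIsometry s i ^ n * familyAt s u d = familyAt s u (n • Pi.single i 1 + d) := by
  induction n with
  | zero => simp
  | succ n ih =>
    rw [pow_succ', mul_assoc, ih, familyIsometry, add_mul, edgeSum_mul_familyAt hs, sub_mul,
      one_mul, familyUnit_mul hs, sub_self, add_zero, succ_nsmul', add_assoc]

theorem commute_familyUnit_vertexProj (u : Option (Fin 2)) :
    Commute (familyUnit s) (sphereVertexProj (familyIsometry s) u) := by
  have h : ∀ i, Commute (familyUnit s) (sphereVertexProj (familyIsometry s) (some i)) := by
    intro i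
    rw [sphereVertexProj, one_sub_familyIsometry_mul_star hs]
    exact (familyUnit_mul hs _ _).trans (mul_familyUnit hs _ _).symm
  rcases u with _ | i
  · rw [sphereVertexProj_none]
    exact ((Commute.one_right _).sub_right (h 0)).sub_right (h 1)
  · exact h i

theorem familyUnit_mul_vertexProj (u : Option (Fin 2)) :
    familyUnit s * sphereVertexProj (familyIsometry s) u = familyAt s u 0 := by
  rcases u with _ | i
  · rw [sphereVertexProj, one_sub_familyIsometry_mul_star hs, one_sub_familyIsometry_mul_star hs,
      mul_sub, mul_sub, mul_one, familyUnit_mul hs, familyUnit_mul hs, familyUnit,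
      Fintype.sum_option, Fin.sum_univ_two]
    abel
  · rw [sphereVertexProj, one_sub_familyIsometry_mul_star hs, familyUnit_mul hs]

theorem commute_familyUnit_sphereFamily {u v : sphereGraph.Obj} (f : u ⟶ v) :
    Commute (familyUnit s) (sphereFamily (familyIsometry s) f) :=
  (((commute_familyUnit_familyIsometry hs 0).pow_right _).mul_right
    ((commute_familyUnit_familyIsometry hs 1).pow_right _)).mul_right
    (commute_familyUnit_vertexProj hs u)

theorem monomial_mul_familyAt (u : Option (Fin 2)) (d : Fin 2 → ℕ) :
    sphereMonomial (familyIsometry s) d * familyAt s u 0 = familyAt s u d := by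
  have hd : d = d 0 • Pi.single 0 1 + (d 1 • Pi.single 1 1 + 0) := by
    ext i
    fin_cases i <;> simp
  rw [sphereMonomial, mul_assoc, familyIsometry_pow_mul_familyAt hs,
    familyIsometry_pow_mul_familyAt hs, ← hd]

/-- Compressing by the unit of the family recovers the family from the isometries built of it. -/
theorem familyUnit_mul_sphereFamily {u v : sphereGraph.Obj} (f : u ⟶ v) :
    familyUnit s * sphereFamily (familyIsometry s) f = s f := by
  have hc : Commute (familyUnit s) (sphereMonomial (familyIsometry s) (sphereGraph.deg f)) :=
    ((commute_familyUnit_familyIsometry hs 0).pow_right _).mul_right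
      ((commute_familyUnit_familyIsometry hs 1).pow_right _)
  rw [sphereFamily, ← mul_assoc, hc.eq, mul_assoc]
  refine (congrArg _ (familyUnit_mul_vertexProj hs u)).trans ?_
  exact (monomial_mul_familyAt hs u _).trans (eq_familyAt f).symm

end

end sphereGraph

/-! ### The isomorphism -/

section

variable {p q : ℝ} (hp : p ∈ Set.Ioo (0 : ℝ) 1) (hq : q ∈ Set.Ioo (0 : ℝ) 1)

namespace QuantumSphereRep

/-- The polar parts of the two generators. -/
def isometries (π : QuantumSphereRep p q) : Fin 2 → π.carrier :=
  ![polarIsometry π.a, polarIsometry π.b]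

include hp hq in
theorem isSphereIsometryPair_isometries (π : QuantumSphereRep p q) :
    IsSphereIsometryPair π.isometries :=
  π.rel.isSphereIsometryPair hp hq

/-- The Cuntz–Krieger family built of the polar parts of the generators. -/
def graphRep (π : QuantumSphereRep p q) : sphereGraph.Rep where
  carrier := π.carrier
  s f := sphereFamily π.isometries f
  rel := (π.isSphereIsometryPair_isometries hp hq).isCuntzKriegerFamily_sphereFamily

/-- The coordinate of the product algebra at a representation. -/
def eval (π : QuantumSphereRep p q) : QuantumSphereProd p q →⋆ₐ[ℂ] π.carrier where
  toFun x := x π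
  map_one' := rfl
  map_mul' _ _ := rfl
  map_zero' := rfl
  map_add' _ _ := rfl
  commutes' _ := rfl
  map_star' _ := rfl

end QuantumSphereRep

theorem map_sphereFamily {A B : Type*} [CStarAlgebra A] [CStarAlgebra B] (φ : A →⋆ₐ[ℂ] B)
    (V : Fin 2 → A) {u v : sphereGraph.Obj} (f : u ⟶ v) :
    φ (sphereFamily V f) = sphereFamily (fun i => φ (V i)) f := by
  rw [sphereFamily, map_mul, sphereMonomial, map_mul, map_pow, map_pow]
  refine congrArg _ ?_
  rcases u with _ | i <;>
    simp only [sphereVertexProj, map_sub, map_one, map_mul, map_star φ]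

/-- Re-indexing of bounded families along `QuantumSphereRep.graphRep`. -/
def restrictRep : sphereGraph.RepProd →⋆ₙₐ[ℂ] QuantumSphereProd p q where
  toFun g := ⟨fun π => g (π.graphRep hp hq), memℓp_infty ⟨‖g‖, by
    rintro _ ⟨π, rfl⟩
    exact lp.norm_apply_le_norm ENNReal.top_ne_zero g (π.graphRep hp hq)⟩⟩
  map_smul' _ _ := rfl
  map_mul' _ _ := rfl
  map_zero' := rfl
  map_add' _ _ := rfl
  map_star' _ := rfl

/-- The polar parts of the canonical generators of `C(S³_pq)`. -/
def universalIsometries : Fin 2 → QuantumSphereProd p q :=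
  ![polarIsometry (quantumSphereA p hq), polarIsometry (quantumSphereB q hp)]

theorem restrictRep_gen {u v : sphereGraph.Obj} (f : u ⟶ v) :
    restrictRep hp hq (sphereGraph.gen f) = sphereFamily (universalIsometries hp hq) f := by
  ext π
  refine Eq.trans ?_ (map_sphereFamily π.eval _ f).symm
  have h : (fun i => π.eval (universalIsometries hp hq i)) = π.isometries := by
    have hr := quantumSphere_rel hp hq
    ext i
    fin_cases i
    · exact map_polarIsometry π.eval hq hr.disc_a
    · exact map_polarIsometry π.eval hp hr.disc_b
  rw [h]
  rfl

theorem continuous_restrictRep : Continuous (restrictRep hp hq) :=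
  (NonUnitalStarAlgHom.instContinuousLinearMapClassComplex
    (F := sphereGraph.RepProd →⋆ₙₐ[ℂ] QuantumSphereProd p q)).toContinuousMapClass.map_continuous
      (restrictRep hp hq)

theorem sum_sphereVertexProj {A : Type*} [Ring A] [StarRing A] (V : Fin 2 → A) :
    ∑ u, sphereVertexProj V u = 1 := by
  rw [Fintype.sum_option, Fin.sum_univ_two, sphereVertexProj_none]
  abel

theorem sphereFamily_mem {A : Type*} [Ring A] [StarRing A] [Algebra ℂ A] [StarModule ℂ A]
    (N : StarSubalgebra ℂ A) {V : Fin 2 → A} (hV : ∀ i, V i ∈ N) {u v : sphereGraph.Obj}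
    (f : u ⟶ v) : sphereFamily V f ∈ N := by
  have h : ∀ i, 1 - V i * star (V i) ∈ N := fun i =>
    sub_mem (one_mem N) (mul_mem (hV i) (star_mem (hV i)))
  refine mul_mem (mul_mem (pow_mem (hV 0) _) (pow_mem (hV 1) _)) ?_
  rcases u with _ | i
  · exact sub_mem (sub_mem (one_mem N) (h 0)) (h 1)
  · exact h i

theorem isClosed_quantumSphereSubalgebra :
    IsClosed (quantumSphereSubalgebra hp hq : Set (QuantumSphereProd p q)) :=
  StarSubalgebra.isClosed_topologicalClosure _

theorem restrictRep_mem {g : sphereGraph.RepProd} (hg : g ∈ sphereGraph.cstarSubalgebra) :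
    restrictRep hp hq g ∈ quantumSphereSubalgebra hp hq := by
  have hsub : StarAlgebra.adjoin ℂ {quantumSphereA p hq, quantumSphereB q hp} ≤
      quantumSphereSubalgebra hp hq := StarSubalgebra.le_topologicalClosure _
  have hV : ∀ i, universalIsometries hp hq i ∈ quantumSphereSubalgebra hp hq := by
    intro i
    fin_cases i
    · exact polarIsometry_mem _ (isClosed_quantumSphereSubalgebra hp hq)
        (hsub (StarAlgebra.subset_adjoin ℂ _ (.inl rfl)))
    · exact polarIsometry_mem _ (isClosed_quantumSphereSubalgebra hp hq)
        (hsub (StarAlgebra.subset_adjoin ℂ _ (.inr rfl)))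
  have hle : sphereGraph.cstarSubalgebra ≤
      (quantumSphereSubalgebra hp hq).toNonUnitalStarSubalgebra.comap (restrictRep hp hq) := by
    refine NonUnitalStarSubalgebra.topologicalClosure_minimal _
      (NonUnitalStarAlgebra.adjoin_le ?_)
      ((isClosed_quantumSphereSubalgebra hp hq).preimage (continuous_restrictRep hp hq))
    rintro _ ⟨u, v, f, rfl⟩
    change restrictRep hp hq (sphereGraph.gen f) ∈ quantumSphereSubalgebra hp hq
    rw [restrictRep_gen]
    exact sphereFamily_mem _ hV f
  exact hle hg

/-- The representation of the relations of `S³_pq` given by a Cuntz–Krieger family, in the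
unitization of its target algebra. -/
def HigherRankGraph.Rep.sphereRep (σ : sphereGraph.Rep) : QuantumSphereRep p q :=
  have hs := σ.rel.map sphereGraph.rowFinite (Unitization.inrNonUnitalStarAlgHom ℂ σ.carrier)
  { carrier := Unitization ℂ σ.carrier
    a := discGenerator q (sphereGraph.familyIsometry
      (fun {_ _} f => Unitization.inrNonUnitalStarAlgHom ℂ σ.carrier (σ.s f)) 0)
    b := discGenerator p (sphereGraph.familyIsometry
      (fun {_ _} f => Unitization.inrNonUnitalStarAlgHom ℂ σ.carrier (σ.s f)) 1)
    rel := (sphereGraph.isSphereIsometryPair_familyIsometry hs).isQuantumSpherePair hp hq }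

/-- Every Cuntz–Krieger family is a compression of the one that belongs to a representation of the
relations of `S³_pq`, so an element of `C⋆(Λ)` that vanishes at all of the latter is zero. -/
theorem eq_zero_of_restrictRep_eq_zero {g : sphereGraph.RepProd}
    (hg : g ∈ sphereGraph.cstarSubalgebra)
    (h0 : restrictRep hp hq g = 0) : g = 0 := by
  ext σ
  have hs := σ.rel.map sphereGraph.rowFinite (Unitization.inrNonUnitalStarAlgHom ℂ σ.carrier)
  have hV := sphereGraph.isSphereIsometryPair_familyIsometry hs
  let π : QuantumSphereRep p q := σ.sphereRep hp hq
  let e : Unitization ℂ σ.carrier := sphereGraph.familyUnit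
    (fun {_ _} f => Unitization.inrNonUnitalStarAlgHom ℂ σ.carrier (σ.s f))
  let ev : sphereGraph.RepProd → Unitization ℂ σ.carrier := fun g => g (π.graphRep hp hq)
  have hev : ∀ {u v : sphereGraph.Obj} (f : u ⟶ v), ev (sphereGraph.gen f) =
      sphereFamily (sphereGraph.familyIsometry
        (fun {_ _} f => Unitization.inrNonUnitalStarAlgHom ℂ σ.carrier (σ.s f))) f := by
    intro u v f
    have : π.isometries = sphereGraph.familyIsometry
        (fun {_ _} f => Unitization.inrNonUnitalStarAlgHom ℂ σ.carrier (σ.s f)) := by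
      ext i : 1
      fin_cases i
      · exact polarIsometry_discGenerator hq (hV.isometry 0)
      · exact polarIsometry_discGenerator hp (hV.isometry 1)
    change sphereFamily π.isometries f = _
    rw [this]
    rfl
  have he : star e = e := sphereGraph.star_familyUnit hs
  have hee : e * e = e := sphereGraph.familyUnit_mul_self hs
  -- The elements whose coordinate at `σ` is the compression by `e` of their coordinate at the
  -- family of `π`. That `e` commutes with the latter makes these elements an algebra.
  let N : NonUnitalStarSubalgebra ℂ sphereGraph.RepProd :=
    { carrier := {g | e * ev g = Unitization.inr (g σ) ∧ e * ev g = ev g * e}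
      zero_mem' := ⟨(mul_zero e).trans (Unitization.inr_zero ℂ).symm,
        (mul_zero e).trans (zero_mul e).symm⟩
      add_mem' := by
        rintro x y ⟨hx, hx'⟩ ⟨hy, hy'⟩
        have h : ev (x + y) = ev x + ev y := rfl
        refine ⟨?_, ?_⟩
        · rw [h, mul_add, hx, hy]
          exact (Unitization.inr_add ℂ _ _).symm
        · rw [h, mul_add, add_mul, hx', hy']
      mul_mem' := by
        rintro x y ⟨hx, hx'⟩ ⟨hy, hy'⟩
        have h : ev (x * y) = ev x * ev y := rfl
        refine ⟨?_, ?_⟩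
        · have : e * (ev x * ev y) = (e * ev x) * (e * ev y) := by
            rw [hx', mul_assoc, ← mul_assoc e e, hee, ← mul_assoc, hx', mul_assoc]
          rw [h, this, hx, hy]
          exact (Unitization.inr_mul ℂ _ _).symm
        · rw [h, ← mul_assoc, hx', mul_assoc, hy', mul_assoc]
      smul_mem' := by
        rintro c x ⟨hx, hx'⟩
        have h : ev (c • x) = c • ev x := rfl
        refine ⟨?_, ?_⟩
        · rw [h, mul_smul_comm, hx]
          exact (Unitization.inr_smul ℂ c _).symm
        · rw [h, mul_smul_comm, smul_mul_assoc, hx']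
      star_mem' := by
        rintro x ⟨hx, hx'⟩
        have h : ev (star x) = star (ev x) := rfl
        have h' : e * star (ev x) = star (e * ev x) := by rw [hx', star_mul, he]
        refine ⟨?_, ?_⟩
        · rw [h, h', hx]
          exact (Unitization.inr_star _).symm
        · rw [h, h', star_mul, he] }
  have hle : sphereGraph.cstarSubalgebra ≤ N := by
    have c1 : Continuous ev :=
      (lp.lipschitzWith_one_eval (E := fun π : sphereGraph.Rep => π.carrier) ∞
        (π.graphRep hp hq)).continuous
    have c2 : Continuous fun g : sphereGraph.RepProd =>
        (Unitization.inr (g σ) : Unitization ℂ σ.carrier) :=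
      (Unitization.isometry_inr (𝕜 := ℂ) (A := σ.carrier)).continuous.comp
        (lp.lipschitzWith_one_eval (E := fun π : sphereGraph.Rep => π.carrier) ∞ σ).continuous
    refine NonUnitalStarSubalgebra.topologicalClosure_minimal _
      (NonUnitalStarAlgebra.adjoin_le ?_)
      ((isClosed_eq (continuous_const.mul c1) c2).inter
        (isClosed_eq (continuous_const.mul c1) (c1.mul continuous_const)))
    rintro _ ⟨u, v, f, rfl⟩
    refine ⟨?_, ?_⟩
    · rw [hev]
      exact sphereGraph.familyUnit_mul_sphereFamily hs f
    · rw [hev]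
      exact (sphereGraph.commute_familyUnit_sphereFamily hs f).eq
  have h1 : ev g = 0 := congrArg (fun x : QuantumSphereProd p q => x π) h0
  have h2 := (hle hg).1
  rw [h1, mul_zero] at h2
  exact Unitization.inr_injective h2.symm

/-- The homomorphism from `C⋆(Λ)` to the product over the representations of the relations of
`S³_pq`; its range is `C(S³_pq)`. -/
def graphHom : sphereGraph.GraphCStarAlgebra →⋆ₙₐ[ℂ] QuantumSphereProd p q :=
  (restrictRep hp hq).comp (NonUnitalStarSubalgebraClass.subtype sphereGraph.cstarSubalgebra)

theorem graphHom_injective : Function.Injective (graphHom hp hq) := by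
  refine (injective_iff_map_eq_zero _).2 fun g hg => Subtype.ext ?_
  exact eq_zero_of_restrictRep_eq_zero hp hq g.2 hg

theorem isClosed_range_graphHom : IsClosed (Set.range (graphHom hp hq)) :=
  (AddMonoidHomClass.isometry_of_norm (graphHom hp hq)
    (NonUnitalStarAlgHom.norm_map _ (graphHom_injective hp hq))).isClosedEmbedding.isClosed_range

theorem sphereFamily_mem_range {u v : sphereGraph.Obj} (f : u ⟶ v) :
    sphereFamily (universalIsometries hp hq) f ∈ NonUnitalStarAlgHom.range (graphHom hp hq) :=
  ⟨⟨sphereGraph.gen f, NonUnitalStarSubalgebra.le_topologicalClosure _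
    (NonUnitalStarAlgebra.subset_adjoin ℂ _ ⟨u, v, f, rfl⟩)⟩, restrictRep_gen hp hq f⟩

theorem vertexProj_mem_range (u : Option (Fin 2)) :
    sphereVertexProj (universalIsometries hp hq) u ∈
      NonUnitalStarAlgHom.range (graphHom hp hq) := by
  have := sphereFamily_mem_range hp hq (sphereGraph.path u 0 rfl)
  simpa [sphereFamily, sphereMonomial, sphereGraph.path, sphereGraph] using this

theorem universalIsometries_mem_range (i : Fin 2) :
    universalIsometries hp hq i ∈ NonUnitalStarAlgHom.range (graphHom hp hq) := by
  have h : universalIsometries hp hq i = ∑ u, universalIsometries hp hq i *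
      sphereVertexProj (universalIsometries hp hq) u := by
    rw [← Finset.mul_sum, sum_sphereVertexProj, mul_one]
  rw [h]
  refine sum_mem fun u _ => ?_
  have := sphereFamily_mem_range hp hq (sphereGraph.path u (Pi.single i 1) rfl)
  fin_cases i <;> simpa [sphereFamily, sphereMonomial, sphereGraph.path, sphereGraph] using this

theorem quantumSphereSubalgebra_subset_range {x : QuantumSphereProd p q}
    (hx : x ∈ quantumSphereSubalgebra hp hq) : ∃ g, graphHom hp hq g = x := by
  have h1 : (1 : QuantumSphereProd p q) ∈ NonUnitalStarAlgHom.range (graphHom hp hq) := by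
    rw [← sum_sphereVertexProj (universalIsometries hp hq)]
    exact sum_mem fun u _ => vertexProj_mem_range hp hq u
  let N : StarSubalgebra ℂ (QuantumSphereProd p q) :=
    { NonUnitalStarAlgHom.range (graphHom hp hq) with
      one_mem' := h1
      algebraMap_mem' := fun c => by
        rw [Algebra.algebraMap_eq_smul_one]
        exact SMulMemClass.smul_mem c h1 }
  have hN : IsClosed (N : Set (QuantumSphereProd p q)) := isClosed_range_graphHom hp hq
  have hr := quantumSphere_rel hp hq
  have hle : quantumSphereSubalgebra hp hq ≤ N := by
    refine StarSubalgebra.topologicalClosure_minimal (StarAlgebra.adjoin_le ?_) hN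
    rintro _ (rfl | rfl)
    · rw [← discGenerator_polarIsometry hq hr.disc_a]
      exact discGenerator_mem N hN (universalIsometries_mem_range hp hq 0)
    · rw [← discGenerator_polarIsometry hp hr.disc_b]
      exact discGenerator_mem N hN (universalIsometries_mem_range hp hq 1)
  exact hle hx

end

end

theorem mainTheorem7 (p q : ℝ) (hp : p ∈ Set.Ioo (0 : ℝ) 1) (hq : q ∈ Set.Ioo (0 : ℝ) 1) :
    ∃ Λ : HigherRankGraph 2, Λ.RowFinite ∧ Λ.LocallyConvex ∧
      Nonempty (QuantumSphere hp hq ≃⋆ₐ[ℂ] Λ.GraphCStarAlgebra) := by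
  refine ⟨sphereGraph, sphereGraph.rowFinite, sphereGraph.locallyConvex, ⟨StarAlgEquiv.symm ?_⟩⟩
  let φ : sphereGraph.GraphCStarAlgebra →⋆ₙₐ[ℂ] QuantumSphere hp hq :=
    { toFun := fun g => ⟨graphHom hp hq g, restrictRep_mem hp hq g.2⟩
      map_smul' := fun c g => Subtype.ext (map_smul (graphHom hp hq) c g)
      map_zero' := Subtype.ext (map_zero (graphHom hp hq))
      map_add' := fun g h => Subtype.ext (map_add (graphHom hp hq) g h)
      map_mul' := fun g h => Subtype.ext (map_mul (graphHom hp hq) g h)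
      map_star' := fun g => Subtype.ext (map_star (graphHom hp hq) g) }
  refine StarAlgEquiv.ofBijective φ ⟨fun g h hgh => ?_, fun x => ?_⟩
  · exact graphHom_injective hp hq (congrArg Subtype.val hgh)
  · obtain ⟨g, hg⟩ := quantumSphereSubalgebra_subset_range hp hq x.2
    exact ⟨g, Subtype.ext hg⟩
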